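/- Let $n\ge 1$ and consider the nominal model $x_{t+1}=f(x_t)+Bv_t$, $y_t=h(x_t)+Dv_t$ with $x_t\in\mathbb R^n$, $y_t\in\mathbb R^m$, $v_t$ white Gaussian noise with covariance $I_{n+m}$, $B\in\mathbb R^{n\times(n+m)}$ and $D\in\mathbb R^{m\times(n+m)}$ of full row rank with $BD^\top=0$, and $f,h$ bounded on compact sets. Fix a sigma-point rule: maps $(\hat x,P)\mapsto\sigma_i(\hat x,P)\in\mathbb R^n$, $i=1,\dots,p$, mean weights $W_m^i\in\mathbb R$ and covariance weights $W_c^i\ge 0$. Fix a tolerance $c_t>0$, the observation $y_t$, and the mean $\hat x_t$ and covariance matrix $\tilde P_t>0$ of the approximate a priori density $\mathcal N(\hat x_t,\tilde P_t)$ of $x_t$ given $Y_{t-1}=\{y_s: s\le t-1\}$. Put $$\mathcal X^i=\sigma_i(\hat x_t,\tilde P_t),\quad m_y=\sum_i W_m^i h(\mathcal X^i),\quad K_y=\sum_i W_c^i(h(\mathcal X^i)-m_y)(h(\mathcal X^i)-m_y)^\top+DD^\top,$$ $$L=\sum_i W_c^i(\mathcal X^i-\hat x_t)(h(\mathcal X^i)-m_y)^\top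 K_y^{-1},\quad \hat{\mathcal X}^i=f\big(\sigma_i(\hat x_t+L(y_t-m_y),\ \tilde P_t-LK_yL^\top)\big),$$ $$\hat x_{t+1}=\sum_i W_m^i\hat{\mathcal X}^i,\qquad P_{t+1}=\sum_i W_c^i(\hat{\mathcal X}^i-\hat x_{t+1})(\hat{\mathcal X}^i-\hat x_{t+1})^\top+BB^\top .$$ Let $d=1-\sum_i W_c^i(h(\mathcal X^i)-m_y)^\top K_y^{-1}(y_t-m_y)$, assume $d\ne 0$, and let $$m_x=\frac1d\Big(\hat x_{t+1}-\sum_i W_c^i f(\mathcal X^i)(h(\mathcal X^i)-m_y)^\top K_y^{-1}(y_t-m_y)\Big),\quad K_{xy}=\sum_i W_c^i(f(\mathcal X^i)-m_x)(h(\mathcal X^i)-m_y)^\top,$$ $$K_x=P_{t+1}+K_{xy}K_y^{-1}K_{xy}^\top .$$ The pseudo-nominal density of $z=[x;y]$ (standing for $z_t=[x_{t+1};y_t]$) given $Y_{t-1}$ is replaced by the sigma-point approximation $\bar p=\mathcal N\left(\begin{bmatrix}m_x\\ m_y\end{bmatrix},\begin{bmatrix}K_x&K_{xy}\\K_{xy}^\top&K_y\end{bmatrix}\right)$.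 Let $\bar{\mathcal B}$ be the set of probability densities $\tilde p$ on $\mathbb R^{n+m}$ with Kullback-Leibler divergence $\mathcal D_{KL}(\tilde p,\bar p)\le c_t$, let $\mathcal G$ be the set of measurable $g:\mathbb R^m\to\mathbb R^n$ with $\int\|g(y)\|^2\tilde p(z)\,dz<\infty$ for all $\tilde p\in\bar{\mathcal B}$, and let $\bar J(\tilde p,g)=\frac12\int\|x-g(y)\|^2\tilde p(z)\,dz$. Then: 1. $\bar p$ is a nondegenerate Gaussian density, and the problem $\min_{g\in\mathcal G}\max_{\tilde p\in\bar{\mathcal B}}\bar J(\tilde p,g)$ is solved by $g^\star(y)=m_x+K_{xy}K_y^{-1}(y-m_y)$, which is its only solution up to Lebesgue-null sets. Its value at the actual observation is the sigma-point predictor: $g^\star(y_t)=\hat x_{t+1}$. 2. $P_{t+1}>0$, and $P_{t+1}$ is the covariance matrix of the prediction error $x-g^\star(y)$ under $\bar p$; moreover, under $\bar p$ the conditional density of $x$ given $y=y_t$ is $\mathcal N(\hat x_{t+1},P_{t+1})$. 3. With $\gamma(P,\theta)=\frac12\left(\log\det(I-\theta P)+\operatorname{tr}\left((I-\theta P)^{-1}-I\right)\right)$,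 there is exactly one $\theta_t>0$ with $I-\theta_tP_{t+1}>0$ and $\gamma(P_{t+1},\theta_t)=c_t$. 4. $\tilde P_{t+1}=(P_{t+1}^{-1}-\theta_tI)^{-1}$ is positive definite, and the maximizer of $\bar J(\cdot,g^\star)$ over $\bar{\mathcal B}$, unique up to Lebesgue-null sets, is the density $\tilde p^\star=\mathcal N\left(\begin{bmatrix}m_x\\ m_y\end{bmatrix},\begin{bmatrix}\tilde P_{t+1}+K_{xy}K_y^{-1}K_{xy}^\top&K_{xy}\\K_{xy}^\top&K_y\end{bmatrix}\right)$; $(\tilde p^\star,g^\star)$ is a saddle point, i.e. $\bar J(\tilde p^\star,g^\star)\le\bar J(\tilde p^\star,g)$ for all $g\in\mathcal G$. The least favorable covariance matrix of the prediction error, i.e. that of $x-g^\star(y)$ under $\tilde p^\star$, is $\tilde P_{t+1}$. 5. The least favorable a priori density at the next stage, i.e. the conditional density of $x$ given $y=y_t$ under $\tilde p^\star$ (which approximates $\tilde p_t(x_{t+1}|Y_t)$), is $\mathcal N(\hat x_{t+1},\tilde P_{t+1})$. -/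

import Mathlib

open MeasureTheory ProbabilityTheory Matrix
open scoped ENNReal

noncomputable section

/-! ### Densities on `ℝⁿ × ℝᵐ` and the minimax game

A vector `z = [x; y]` is a function on `Fin n ⊕ Fin m`, with `x = z ∘ Sum.inl` and
`y = z ∘ Sum.inr`. -/

/-- The density of `N(μ, S)` on `ℝ^ι` (for `S` positive definite). -/
def gaussianDensity {ι : Type} [Fintype ι] [DecidableEq ι] (μ : ι → ℝ) (S : Matrix ι ι ℝ)
    (z : ι → ℝ) : ℝ :=
  (Real.sqrt ((2 * Real.pi) ^ Fintype.card ι * S.det))⁻¹ *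
    Real.exp (-(1 / 2) * ((z - μ) ⬝ᵥ (S⁻¹ *ᵥ (z - μ))))

/-- `q` is a probability density on `ℝ^ι` with respect to Lebesgue measure. -/
structure IsProbDensity {ι : Type} [Fintype ι] (q : (ι → ℝ) → ℝ) : Prop where
  measurable : Measurable q
  nonneg : ∀ z, 0 ≤ q z
  lintegral_eq_one : ∫⁻ z, ENNReal.ofReal (q z) = 1

/-- The measure with density `q`. -/
def densityMeasure {ι : Type} [Fintype ι] (q : (ι → ℝ) → ℝ) : Measure (ι → ℝ) :=
  volume.withDensity fun z => ENNReal.ofReal (q z)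

/-- The ambiguity set: probability densities `q` with `KL(q, q₀) ≤ c`. -/
def klBall {ι : Type} [Fintype ι] (q₀ : (ι → ℝ) → ℝ) (c : ℝ) : Set ((ι → ℝ) → ℝ) :=
  {q | IsProbDensity q ∧
    InformationTheory.klDiv (densityMeasure q) (densityMeasure q₀) ≤ ENNReal.ofReal c}

variable {n m p : ℕ}

/-- The prediction error `x - g(y)` at `z = [x; y]`. -/
def predError (g : (Fin m → ℝ) → (Fin n → ℝ)) (z : Fin n ⊕ Fin m → ℝ) : Fin n → ℝ :=
  z ∘ Sum.inl - g (z ∘ Sum.inr)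

/-- The objective `½ ∫ ‖x - g(y)‖² q(z) dz` (Euclidean norm), with values in `[0, ∞]`. -/
def cost (q : (Fin n ⊕ Fin m → ℝ) → ℝ) (g : (Fin m → ℝ) → (Fin n → ℝ)) : ℝ≥0∞ :=
  2⁻¹ * ∫⁻ z, ENNReal.ofReal (predError g z ⬝ᵥ predError g z) * ENNReal.ofReal (q z)

/-- The estimators with finite second-order moments under every density in the ball. -/
def estimators (q₀ : (Fin n ⊕ Fin m → ℝ) → ℝ) (c : ℝ) : Set ((Fin m → ℝ) → (Fin n → ℝ)) :=
  {g | Measurable g ∧ ∀ q ∈ klBall q₀ c,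
    ∫⁻ z, ENNReal.ofReal (g (z ∘ Sum.inr) ⬝ᵥ g (z ∘ Sum.inr)) * ENNReal.ofReal (q z) < ∞}

/-- `g` attains the outer minimum of `min_g max_{q ∈ ball} cost q g`. -/
def IsMinimaxEstimator (q₀ : (Fin n ⊕ Fin m → ℝ) → ℝ) (c : ℝ)
    (g : (Fin m → ℝ) → (Fin n → ℝ)) : Prop :=
  g ∈ estimators q₀ c ∧
    ∀ g' ∈ estimators q₀ c, (⨆ q ∈ klBall q₀ c, cost q g) ≤ ⨆ q ∈ klBall q₀ c, cost q g'

/-- `q` attains the inner maximum `max_{q ∈ ball} cost q g` for the estimator `g`. -/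
def IsLeastFavorable (q₀ : (Fin n ⊕ Fin m → ℝ) → ℝ) (c : ℝ)
    (g : (Fin m → ℝ) → (Fin n → ℝ)) (q : (Fin n ⊕ Fin m → ℝ) → ℝ) : Prop :=
  q ∈ klBall q₀ c ∧ ∀ q' ∈ klBall q₀ c, cost q' g ≤ cost q g

/-- Under the density `q`, the prediction error of `g` is square integrable with
covariance matrix `S`. -/
def HasErrorCovariance (q : (Fin n ⊕ Fin m → ℝ) → ℝ) (g : (Fin m → ℝ) → (Fin n → ℝ))
    (S : Matrix (Fin n) (Fin n) ℝ) : Prop :=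
  (∀ i, MemLp (fun z => predError g z i) 2 (densityMeasure q)) ∧
    ∀ i j, covariance (fun z => predError g z i) (fun z => predError g z j)
      (densityMeasure q) = S i j

/-- The conditional density of `x` given `y` under the joint density `q` of `[x; y]`. -/
def condDensity (q : (Fin n ⊕ Fin m → ℝ) → ℝ) (y : Fin m → ℝ) (x : Fin n → ℝ) : ℝ :=
  q (Sum.elim x y) / ∫ x' : Fin n → ℝ, q (Sum.elim x' y)

/-- `γ(P, θ) = ½ (log det(I - θP) + tr((I - θP)⁻¹ - I))`. -/
def gammaFun (P : Matrix (Fin n) (Fin n) ℝ) (θ : ℝ) : ℝ :=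
  1 / 2 * (Real.log (1 - θ • P).det + ((1 - θ • P)⁻¹ - 1).trace)

/-! ### The nominal model and sigma-point rules -/

/-- The nominal model `x_{t+1} = f(x_t) + B v_t`, `y_t = h(x_t) + D v_t`. -/
structure NominalModel (n m : ℕ) where
  f : (Fin n → ℝ) → (Fin n → ℝ)
  h : (Fin n → ℝ) → (Fin m → ℝ)
  B : Matrix (Fin n) (Fin (n + m)) ℝ
  D : Matrix (Fin m) (Fin (n + m)) ℝ
  rank_B : B.rank = n
  rank_D : D.rank = m
  orthogonal : B * Dᵀ = 0
  bounded_f : ∀ C : Set (Fin n → ℝ), IsCompact C → Bornology.IsBounded (f '' C)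
  bounded_h : ∀ C : Set (Fin n → ℝ), IsCompact C → Bornology.IsBounded (h '' C)

/-- A sigma-point rule with `p` points: points `σᵢ(x, P)`, weights for the mean, and
nonnegative weights for the covariance. -/
structure SigmaPointRule (n p : ℕ) where
  point : Fin p → (Fin n → ℝ) → Matrix (Fin n) (Fin n) ℝ → (Fin n → ℝ)
  Wm : Fin p → ℝ
  Wc : Fin p → ℝ
  Wc_nonneg : ∀ i, 0 ≤ Wc i

/-- The data of one time step: the model, the sigma-point rule, the mean and covariance matrix
of the approximate a priori density of `x_t` given `Y_{t-1}`, and the observation `y_t`. -/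
structure FilterStep (n m p : ℕ) where
  model : NominalModel n m
  rule : SigmaPointRule n p
  xhat : Fin n → ℝ
  Pt : Matrix (Fin n) (Fin n) ℝ
  y : Fin m → ℝ

namespace FilterStep

/-! ### The sigma-point recursion -/

/-- `Xⁱ = σᵢ(x̂_t, P̃_t)`. -/
def X (s : FilterStep n m p) (i : Fin p) : Fin n → ℝ := s.rule.point i s.xhat s.Pt

/-- `m_y = ∑ W_mⁱ h(Xⁱ)`. -/
def my (s : FilterStep n m p) : Fin m → ℝ := ∑ i, s.rule.Wm i • s.model.h (s.X i)

/-- `h(Xⁱ) - m_y`. -/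
def hErr (s : FilterStep n m p) (i : Fin p) : Fin m → ℝ := s.model.h (s.X i) - s.my

/-- `K_y = ∑ W_cⁱ (h(Xⁱ) - m_y)(h(Xⁱ) - m_y)ᵀ + D Dᵀ`. -/
def Ky (s : FilterStep n m p) : Matrix (Fin m) (Fin m) ℝ :=
  ∑ i, s.rule.Wc i • vecMulVec (s.hErr i) (s.hErr i) + s.model.D * s.model.Dᵀ

/-- The gain `L = ∑ W_cⁱ (Xⁱ - x̂_t)(h(Xⁱ) - m_y)ᵀ K_y⁻¹`. -/
def L (s : FilterStep n m p) : Matrix (Fin n) (Fin m) ℝ :=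
  (∑ i, s.rule.Wc i • vecMulVec (s.X i - s.xhat) (s.hErr i)) * s.Ky⁻¹

/-- The updated state `x̂_{t|t} = x̂_t + L (y_t - m_y)`. -/
def xUpd (s : FilterStep n m p) : Fin n → ℝ := s.xhat + s.L *ᵥ (s.y - s.my)

/-- The updated covariance `P_{t|t} = P̃_t - L K_y Lᵀ`. -/
def PUpd (s : FilterStep n m p) : Matrix (Fin n) (Fin n) ℝ := s.Pt - s.L * s.Ky * s.Lᵀ

/-- `X̂ⁱ = f(σᵢ(x̂_{t|t}, P_{t|t}))`. -/
def Xhat (s : FilterStep n m p) (i : Fin p) : Fin n → ℝ :=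
  s.model.f (s.rule.point i s.xUpd s.PUpd)

/-- The sigma-point predictor `x̂_{t+1} = ∑ W_mⁱ X̂ⁱ`. -/
def xNext (s : FilterStep n m p) : Fin n → ℝ := ∑ i, s.rule.Wm i • s.Xhat i

/-- `P_{t+1} = ∑ W_cⁱ (X̂ⁱ - x̂_{t+1})(X̂ⁱ - x̂_{t+1})ᵀ + B Bᵀ`. -/
def PNext (s : FilterStep n m p) : Matrix (Fin n) (Fin n) ℝ :=
  ∑ i, s.rule.Wc i • vecMulVec (s.Xhat i - s.xNext) (s.Xhat i - s.xNext) +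
    s.model.B * s.model.Bᵀ

/-- The least favorable covariance `P̃_{t+1} = (P_{t+1}⁻¹ - θ I)⁻¹`. -/
def PtNext (s : FilterStep n m p) (θ : ℝ) : Matrix (Fin n) (Fin n) ℝ := (s.PNext⁻¹ - θ • 1)⁻¹

/-! ### The Gaussian sigma-point approximation of the density of `z_t` given `Y_{t-1}` -/

/-- The denominator `1 - ∑ W_cⁱ (h(Xⁱ) - m_y)ᵀ K_y⁻¹ (y_t - m_y)` of `mx`. -/
def den (s : FilterStep n m p) : ℝ :=
  1 - ∑ i, s.rule.Wc i * (s.hErr i ⬝ᵥ (s.Ky⁻¹ *ᵥ (s.y - s.my)))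

/-- The mean of the `x_{t+1}` block,
`(x̂_{t+1} - ∑ W_cⁱ f(Xⁱ)(h(Xⁱ) - m_y)ᵀ K_y⁻¹ (y_t - m_y)) / den`. -/
def mx (s : FilterStep n m p) : Fin n → ℝ :=
  s.den⁻¹ • (s.xNext -
    ((∑ i, s.rule.Wc i • vecMulVec (s.model.f (s.X i)) (s.hErr i)) * s.Ky⁻¹) *ᵥ (s.y - s.my))

/-- The cross covariance `∑ W_cⁱ (f(Xⁱ) - m_x)(h(Xⁱ) - m_y)ᵀ`. -/
def Kxy (s : FilterStep n m p) : Matrix (Fin n) (Fin m) ℝ :=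
  ∑ i, s.rule.Wc i • vecMulVec (s.model.f (s.X i) - s.mx) (s.hErr i)

/-- The `x_{t+1}` block `∑ W_cⁱ (X̂ⁱ - x̂_{t+1})(X̂ⁱ - x̂_{t+1})ᵀ + B Bᵀ + K_xy K_y⁻¹ K_xyᵀ`. -/
def Kx (s : FilterStep n m p) : Matrix (Fin n) (Fin n) ℝ :=
  ∑ i, s.rule.Wc i • vecMulVec (s.Xhat i - s.xNext) (s.Xhat i - s.xNext) +
    s.model.B * s.model.Bᵀ + s.Kxy * s.Ky⁻¹ * s.Kxyᵀ

/-- The mean `[m_x; m_y]`. -/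
def mean (s : FilterStep n m p) : Fin n ⊕ Fin m → ℝ := Sum.elim s.mx s.my

/-- The covariance matrix of the Gaussian approximation. -/
def K (s : FilterStep n m p) : Matrix (Fin n ⊕ Fin m) (Fin n ⊕ Fin m) ℝ :=
  fromBlocks s.Kx s.Kxy s.Kxyᵀ s.Ky

/-- The approximate nominal density of `z_t` given `Y_{t-1}`: the center of the ball. -/
def nominal (s : FilterStep n m p) : (Fin n ⊕ Fin m → ℝ) → ℝ := gaussianDensity s.mean s.K

/-- The one-step ahead predictor `y ↦ m_x + K_xy K_y⁻¹ (y - m_y)` based on `nominal`. -/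
def predictor (s : FilterStep n m p) (y : Fin m → ℝ) : Fin n → ℝ :=
  s.mx + (s.Kxy * s.Ky⁻¹) *ᵥ (y - s.my)

/-- The Gaussian density with mean `[m_x; m_y]` whose covariance matrix is that of `nominal` with
the `x_{t+1}` block replaced by `P̃_{t+1} + K_xy K_y⁻¹ K_xyᵀ`. -/
def leastFavorable (s : FilterStep n m p) (θ : ℝ) : (Fin n ⊕ Fin m → ℝ) → ℝ :=
  gaussianDensity s.mean
    (fromBlocks (s.PtNext θ + s.Kxy * s.Ky⁻¹ * s.Kxyᵀ) s.Kxy s.Kxyᵀ s.Ky)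

end FilterStep

end

/-! Write P for `PNext`, g* for `predictor` and e = x - g*(y). The block K_x is built so that the
Schur complement of K_y is P; hence the nominal density factors as N(g*(y), P)(x) · N(m_y, K_y)(y)
(`blockGaussian_sumElim`). Multiplying it by exp(θ/2 ‖e‖²) and normalizing affects the first factor
only: P becomes (P⁻¹ - θI)⁻¹, while g* and the law of y stay the same (`blockGaussian_tilt`). So g*
is the conditional mean under the tilted density too, and is optimal against it
(`cost_affineEstimator_le`).

In the other direction, let ν be the nominal measure, φ = θ/2 ‖e‖², Z = ∫ exp φ dν and ν_φ the
tilted measure. Then KL(μ, ν) = KL(μ, ν_φ) + ∫ φ dμ - log Z. Among all μ that are no further from ν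
than ν_φ is, the integral of φ is therefore largest at ν_φ, and only there
(`integral_le_integral_tilted`). The divergence of ν_φ from ν is γ(P, θ), which increases strictly
from 0 and takes each positive value (`existsUnique_gammaFun_eq`), so exactly one θ puts ν_φ on the
boundary of the ball.

The tilted density and g* thus form a saddle point, from which minimaxity and uniqueness follow. The
sigma points matter in two places only: K_y and P are positive definite, and m_x is chosen to make
g*(y_t) the sigma-point predictor (`predictor_y`). -/

noncomputable section

/-! ### Gaussian densities: normalization, moments, exponential tilting -/

section GaussianDensity

variable {ι : Type} [Fintype ι]

theorem lintegral_densityMeasure {q : (ι → ℝ) → ℝ} (hq : Measurable q) {F : (ι → ℝ) → ℝ≥0∞}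
    (hF : Measurable F) :
    ∫⁻ z, F z ∂densityMeasure q = ∫⁻ z, F z * ENNReal.ofReal (q z) := by
  rw [densityMeasure, lintegral_withDensity_eq_lintegral_mul _ hq.ennreal_ofReal hF]
  simp_rw [Pi.mul_apply, mul_comm]

theorem IsProbDensity.isProbabilityMeasure {q : (ι → ℝ) → ℝ} (hq : IsProbDensity q) :
    IsProbabilityMeasure (densityMeasure q) :=
  ⟨by rw [densityMeasure, withDensity_apply _ MeasurableSet.univ, setLIntegral_univ,
    hq.lintegral_eq_one]⟩

theorem memLp_eval_pi_gaussianReal (i : ι) :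
    MemLp (fun w : ι → ℝ => w i) 2 (Measure.pi fun _ : ι => gaussianReal 0 1) :=
  (memLp_id_gaussianReal 2).comp_measurePreserving (measurePreserving_eval _ i)

omit [Fintype ι] in
theorem measurable_eval_real (i : ι) : Measurable fun z : ι → ℝ => z i :=
  measurable_pi_apply i

theorem dotProduct_self_nonneg (v : ι → ℝ) : 0 ≤ v ⬝ᵥ v :=
  Finset.sum_nonneg fun i _ => mul_self_nonneg (v i)

variable [DecidableEq ι]

theorem gaussianDensity_pos {S : Matrix ι ι ℝ} (hS : S.PosDef) (μ z : ι → ℝ) :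
    0 < gaussianDensity μ S z := by
  have := hS.det_pos
  unfold gaussianDensity
  positivity

theorem continuous_gaussianDensity (μ : ι → ℝ) (S : Matrix ι ι ℝ) :
    Continuous (gaussianDensity μ S) := by
  unfold gaussianDensity
  fun_prop

theorem measurable_gaussianDensity (μ : ι → ℝ) (S : Matrix ι ι ℝ) :
    Measurable (gaussianDensity μ S) :=
  (continuous_gaussianDensity μ S).measurable

/-- The standard Gaussian product measure has density `gaussianDensity 0 1`. -/
theorem pi_gaussianReal_eq_densityMeasure :
    Measure.pi (fun _ : ι => gaussianReal 0 1) =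
      densityMeasure (gaussianDensity (0 : ι → ℝ) 1) := by
  have hprod : ∀ z : ι → ℝ, gaussianDensity 0 1 z = ∏ i, gaussianPDFReal 0 1 (z i) := by
    intro z
    simp only [gaussianDensity, gaussianPDFReal, Finset.prod_mul_distrib, ← Real.exp_sum]
    congr 1
    · rw [det_one, mul_one, Finset.prod_inv_distrib, Finset.prod_const, Finset.card_univ,
        Real.sqrt_eq_rpow, Real.sqrt_eq_rpow, ← Real.rpow_natCast, ← Real.rpow_natCast,
        ← Real.rpow_mul Real.two_pi_pos.le, ← Real.rpow_mul (by positivity), mul_comm (1 / 2 : ℝ)]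
      simp
    · simp only [inv_one, one_mulVec, sub_zero, dotProduct]
      congr 1
      rw [Finset.mul_sum]
      refine Finset.sum_congr rfl fun i _ => ?_
      simp; ring
  refine Measure.pi_eq fun s hs => ?_
  have hint : Integrable (fun z : ι → ℝ => ∏ i, gaussianPDFReal 0 1 (z i)) :=
    Integrable.fintype_prod (f := fun _ => gaussianPDFReal 0 1)
      fun _ => integrable_gaussianPDFReal 0 1
  rw [densityMeasure, withDensity_apply _ (MeasurableSet.univ_pi hs)]
  simp_rw [hprod]
  rw [← ofReal_integral_eq_lintegral_ofReal hint.integrableOn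
    (ae_of_all _ fun z => Finset.prod_nonneg fun i _ => gaussianPDFReal_nonneg 0 1 _),
    volume_pi, Measure.restrict_pi_pi,
    integral_fintype_prod_eq_prod (𝕜 := ℝ) (fun _ : ι => gaussianPDFReal 0 1),
    ENNReal.ofReal_prod_of_nonneg]
  · refine Finset.prod_congr rfl fun i _ => ?_
    rw [gaussianReal_apply_eq_integral _ one_ne_zero]
  · exact fun i _ => integral_nonneg fun x => gaussianPDFReal_nonneg 0 1 x

theorem Matrix.PosDef.exists_mul_transpose_self {S : Matrix ι ι ℝ} (hS : S.PosDef) :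
    ∃ A : Matrix ι ι ℝ, A * Aᵀ = S ∧ A.det ≠ 0 := by
  open scoped MatrixOrder in
  have h0 : 0 ≤ S := Matrix.nonneg_iff_posSemidef.2 hS.posSemidef
  have h1 : CFC.sqrt S * CFC.sqrt S = S := CFC.sqrt_mul_sqrt_self S h0
  have h2 : (CFC.sqrt S)ᵀ = CFC.sqrt S := (CFC.sqrt_nonneg S).isSelfAdjoint
  refine ⟨CFC.sqrt S, by rw [h2, h1], fun h => hS.det_pos.ne' ?_⟩
  rw [← h1, det_mul, h, zero_mul]

theorem gaussianDensity_mul_transpose (μ z : ι → ℝ) (A : Matrix ι ι ℝ) :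
    gaussianDensity μ (A * Aᵀ) z =
      |A.det⁻¹| * gaussianDensity 0 1 (A⁻¹ *ᵥ (z - μ)) := by
  unfold gaussianDensity
  have hq : (A⁻¹ *ᵥ (z - μ)) ⬝ᵥ (A⁻¹ *ᵥ (z - μ)) = (z - μ) ⬝ᵥ ((A * Aᵀ)⁻¹ *ᵥ (z - μ)) := by
    rw [Matrix.mul_inv_rev, ← transpose_nonsing_inv, ← mulVec_mulVec,
      dotProduct_mulVec (z - μ), vecMul_transpose]
  rw [det_mul, det_transpose, det_one, inv_one, one_mulVec, sub_zero, hq, mul_one,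
    Real.sqrt_mul (by positivity), Real.sqrt_mul_self_eq_abs, mul_inv, abs_inv]
  ring

/-- Change of variables z = μ + A w. Normalization, means and covariances of a general Gaussian are
all reduced through it to the standard one, with A a square root of the covariance. -/
theorem densityMeasure_gaussianDensity_eq_map (μ : ι → ℝ) {A : Matrix ι ι ℝ} (hA : A.det ≠ 0) :
    densityMeasure (gaussianDensity μ (A * Aᵀ)) =
      (Measure.pi fun _ : ι => gaussianReal 0 1).map fun w => μ + A *ᵥ w := by
  have hmeas : Measurable fun w : ι → ℝ => μ + A *ᵥ w := by fun_prop
  rw [pi_gaussianReal_eq_densityMeasure]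
  refine Measure.ext_of_lintegral _ fun F hF => ?_
  rw [lintegral_map hF hmeas, lintegral_densityMeasure (measurable_gaussianDensity _ _) hF,
    lintegral_densityMeasure (measurable_gaussianDensity _ _)
      (show Measurable fun w => F (μ + A *ᵥ w) from hF.comp hmeas)]
  -- The integrand as a function of v = A w, so that the linear substitution and the translation by
  -- μ can be carried out separately.
  set H : (ι → ℝ) → ℝ≥0∞ := fun v =>
    F (μ + v) * ENNReal.ofReal (gaussianDensity 0 1 (A⁻¹ *ᵥ v)) with hH
  have hHm : Measurable H := by
    refine Measurable.mul (hF.comp (by fun_prop)) ?_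
    exact ((measurable_gaussianDensity 0 1).comp (by fun_prop)).ennreal_ofReal
  have h1 : ∀ w : ι → ℝ, F (μ + A *ᵥ w) * ENNReal.ofReal (gaussianDensity 0 1 w) =
      H (toLin' A w) := by
    intro w
    simp only [hH, toLin'_apply, mulVec_mulVec, nonsing_inv_mul A hA.isUnit, one_mulVec]
  simp_rw [h1]
  rw [← lintegral_map hHm (by fun_prop), Real.map_matrix_volume_pi_eq_smul_volume_pi hA,
    lintegral_smul_measure, smul_eq_mul, ← lintegral_const_mul _ hHm,
    ← lintegral_sub_right_eq_self (fun v => ENNReal.ofReal |A.det⁻¹| * H v) μ]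
  refine lintegral_congr fun z => ?_
  rw [gaussianDensity_mul_transpose, ENNReal.ofReal_mul (abs_nonneg _)]
  simp only [hH, add_sub_cancel]
  ring

theorem isProbDensity_gaussianDensity (μ : ι → ℝ) {S : Matrix ι ι ℝ} (hS : S.PosDef) :
    IsProbDensity (gaussianDensity μ S) := by
  refine ⟨measurable_gaussianDensity _ _, fun z => (gaussianDensity_pos hS μ z).le, ?_⟩
  obtain ⟨A, rfl, hA⟩ := hS.exists_mul_transpose_self
  have := lintegral_densityMeasure (measurable_gaussianDensity μ (A * Aᵀ))
    (measurable_const (a := (1 : ℝ≥0∞)))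
  rw [densityMeasure_gaussianDensity_eq_map _ hA, lintegral_map measurable_const (by fun_prop)]
    at this
  simpa using this.symm

theorem integral_gaussianDensity (μ : ι → ℝ) {S : Matrix ι ι ℝ} (hS : S.PosDef) :
    ∫ z, gaussianDensity μ S z = 1 := by
  have h := isProbDensity_gaussianDensity μ hS
  rw [integral_eq_lintegral_of_nonneg_ae (ae_of_all _ h.nonneg)
    (measurable_gaussianDensity μ S).aestronglyMeasurable, h.lintegral_eq_one,
    ENNReal.toReal_one]

theorem covariance_eval_pi_gaussianReal (i j : ι) :
    covariance (fun w : ι → ℝ => w i) (fun w => w j) (Measure.pi fun _ : ι => gaussianReal 0 1) =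
      (1 : Matrix ι ι ℝ) i j := by
  rcases eq_or_ne i j with rfl | hij
  · rw [covariance_self (measurable_eval_real i).aemeasurable, one_apply_eq]
    have h := (measurePreserving_eval (fun _ : ι => gaussianReal 0 1) i)
    have := variance_map (X := fun x : ℝ => x) (μ := Measure.pi fun _ : ι => gaussianReal 0 1)
      (Y := fun w : ι → ℝ => w i) (by fun_prop) (measurable_eval_real i).aemeasurable
    have h' : Measure.map (fun w : ι → ℝ => w i) (Measure.pi fun _ : ι => gaussianReal 0 1) =
      gaussianReal 0 1 := h.map_eq
    rw [h', variance_fun_id_gaussianReal] at this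
    simpa [Function.comp_def] using this.symm
  · rw [one_apply_ne hij]
    refine IndepFun.covariance_eq_zero ?_ (memLp_eval_pi_gaussianReal i)
      (memLp_eval_pi_gaussianReal j)
    exact (iIndepFun_pi (μ := fun _ : ι => gaussianReal 0 1) (X := fun _ x => x)
      fun _ => by fun_prop).indepFun hij

theorem memLp_eval_gaussianDensity (μ : ι → ℝ) {S : Matrix ι ι ℝ} (hS : S.PosDef) (i : ι) :
    MemLp (fun z : ι → ℝ => z i) 2 (densityMeasure (gaussianDensity μ S)) := by
  obtain ⟨A, rfl, hA⟩ := hS.exists_mul_transpose_self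
  rw [densityMeasure_gaussianDensity_eq_map _ hA,
    memLp_map_measure_iff (measurable_eval_real i).aestronglyMeasurable (by fun_prop)]
  refine (memLp_const (μ i)).add ?_
  exact memLp_finsetSum _ fun j _ => (memLp_eval_pi_gaussianReal j).const_mul (A i j)

theorem integral_eval_gaussianDensity (μ : ι → ℝ) {S : Matrix ι ι ℝ} (hS : S.PosDef) (i : ι) :
    ∫ z, z i ∂densityMeasure (gaussianDensity μ S) = μ i := by
  obtain ⟨A, rfl, hA⟩ := hS.exists_mul_transpose_self
  have hint : ∀ j, Integrable (fun w : ι → ℝ => A i j * w j)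
      (Measure.pi fun _ : ι => gaussianReal 0 1) := fun j =>
    ((memLp_eval_pi_gaussianReal j).integrable (by norm_num)).const_mul _
  have hmean : ∀ j, ∫ w : ι → ℝ, w j ∂(Measure.pi fun _ : ι => gaussianReal 0 1) = 0 := by
    intro j
    rw [integral_eval]
    · exact integral_id_gaussianReal
  rw [densityMeasure_gaussianDensity_eq_map _ hA, integral_map (by fun_prop)
    (measurable_eval_real i).aestronglyMeasurable]
  simp only [Pi.add_apply, mulVec, dotProduct]
  rw [integral_add (integrable_const _) (integrable_finsetSum _ fun j _ => hint j),
    integral_finsetSum _ fun j _ => hint j]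
  simp [integral_const_mul, hmean]

theorem covariance_eval_gaussianDensity (μ : ι → ℝ) {S : Matrix ι ι ℝ} (hS : S.PosDef)
    (i j : ι) :
    covariance (fun z : ι → ℝ => z i) (fun z => z j) (densityMeasure (gaussianDensity μ S)) =
      S i j := by
  obtain ⟨A, rfl, hA⟩ := hS.exists_mul_transpose_self
  have hL : ∀ i j, MemLp (fun w : ι → ℝ => A i j * w j) 2
      (Measure.pi fun _ : ι => gaussianReal 0 1) :=
    fun i j => (memLp_eval_pi_gaussianReal j).const_mul _
  have hint : ∀ i, Integrable (fun w : ι → ℝ => ∑ j, A i j * w j)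
      (Measure.pi fun _ : ι => gaussianReal 0 1) := fun i =>
    integrable_finsetSum _ fun j _ => (hL i j).integrable (by norm_num)
  rw [densityMeasure_gaussianDensity_eq_map _ hA,
    covariance_map_fun (measurable_eval_real i).aestronglyMeasurable
      (measurable_eval_real j).aestronglyMeasurable (by fun_prop)]
  simp only [Pi.add_apply, mulVec, dotProduct]
  rw [covariance_const_add_left (hint i), covariance_const_add_right (hint j),
    covariance_fun_sum_fun_sum (hL i) (hL j), mul_apply]
  simp_rw [covariance_const_mul_left, covariance_const_mul_right, covariance_eval_pi_gaussianReal,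
    one_apply]
  simp

theorem memLp_eval_sub_gaussianDensity (μ b : ι → ℝ) {S : Matrix ι ι ℝ} (hS : S.PosDef) (i : ι) :
    MemLp (fun z : ι → ℝ => z i - b i) 2 (densityMeasure (gaussianDensity μ S)) := by
  have := (isProbDensity_gaussianDensity μ hS).isProbabilityMeasure
  exact (memLp_eval_gaussianDensity μ hS i).sub (memLp_const _)

theorem integrable_dotProduct_gaussianDensity (μ b : ι → ℝ) {S : Matrix ι ι ℝ} (hS : S.PosDef) :
    Integrable (fun z => (z - b) ⬝ᵥ (z - b)) (densityMeasure (gaussianDensity μ S)) := by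
  simp only [dotProduct, Pi.sub_apply, ← pow_two]
  exact integrable_finsetSum _ fun i _ => (memLp_eval_sub_gaussianDensity μ b hS i).integrable_sq

/-- Variance plus squared bias, coordinate by coordinate. The point b is arbitrary because it will
be the value g(y) of a competing estimator. -/
theorem integral_dotProduct_gaussianDensity (μ b : ι → ℝ) {S : Matrix ι ι ℝ} (hS : S.PosDef) :
    ∫ z, (z - b) ⬝ᵥ (z - b) ∂densityMeasure (gaussianDensity μ S) =
      S.trace + (μ - b) ⬝ᵥ (μ - b) := by
  have := (isProbDensity_gaussianDensity μ hS).isProbabilityMeasure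
  simp only [dotProduct, Pi.sub_apply, ← pow_two, trace, diag_apply]
  rw [integral_finsetSum _ fun i _ => (memLp_eval_sub_gaussianDensity μ b hS i).integrable_sq,
    ← Finset.sum_add_distrib]
  refine Finset.sum_congr rfl fun i _ => ?_
  have hint := (memLp_eval_gaussianDensity μ hS i).integrable (by norm_num)
  have h1 := variance_eq_sub (memLp_eval_sub_gaussianDensity μ b hS i)
  rw [← covariance_self (memLp_eval_sub_gaussianDensity μ b hS i).aemeasurable,
    covariance_sub_const_left hint,
    covariance_sub_const_right hint, covariance_eval_gaussianDensity μ hS,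
    integral_sub hint (integrable_const _), integral_eval_gaussianDensity μ hS] at h1
  simp at h1
  linarith

theorem lintegral_dotProduct_gaussianDensity (μ b : ι → ℝ) {S : Matrix ι ι ℝ} (hS : S.PosDef) :
    ∫⁻ z, ENNReal.ofReal ((z - b) ⬝ᵥ (z - b)) * ENNReal.ofReal (gaussianDensity μ S z) =
      ENNReal.ofReal (S.trace + (μ - b) ⬝ᵥ (μ - b)) := by
  rw [← lintegral_densityMeasure (measurable_gaussianDensity μ S)
      (by unfold dotProduct; fun_prop),
    ← ofReal_integral_eq_lintegral_ofReal (integrable_dotProduct_gaussianDensity μ b hS)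
      (ae_of_all _ fun z => dotProduct_self_nonneg _),
    integral_dotProduct_gaussianDensity μ b hS]

/-- Multiplying a Gaussian density by `exp (θ/2 ‖z - μ‖²)` gives, up to normalization, another
Gaussian density. -/
theorem exp_mul_gaussianDensity (μ z : ι → ℝ) {S : Matrix ι ι ℝ} (hS : S.PosDef) {θ : ℝ}
    (hθ : (S⁻¹ - θ • 1).PosDef) :
    Real.exp (θ / 2 * ((z - μ) ⬝ᵥ (z - μ)) + 1 / 2 * Real.log (1 - θ • S).det) *
        gaussianDensity μ S z =
      gaussianDensity μ (S⁻¹ - θ • 1)⁻¹ z := by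
  have hS0 := hS.det_pos
  have hdet : (1 - θ • S).det = S.det * (S⁻¹ - θ • 1).det := by
    rw [← det_mul, mul_sub, mul_nonsing_inv _ hS0.ne'.isUnit]
    simp
  have hT0 := hθ.det_pos
  unfold gaussianDensity
  generalize z - μ = v
  rw [nonsing_inv_nonsing_inv _ hT0.ne'.isUnit, det_nonsing_inv, Ring.inverse_eq_inv',
    Real.sqrt_mul (by positivity), Real.sqrt_mul (by positivity), Real.exp_add, hdet,
    show 1 / 2 * Real.log (S.det * (S⁻¹ - θ • 1).det) =
      Real.log (√(S.det * (S⁻¹ - θ • 1).det)) by rw [Real.log_sqrt (by positivity)]; ring,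
    Real.exp_log (by positivity), Real.sqrt_mul hS0.le, Real.sqrt_inv, sub_mulVec,
    dotProduct_sub v, smul_mulVec, one_mulVec, dotProduct_smul, smul_eq_mul,
    show -(1 / 2 : ℝ) * (v ⬝ᵥ S⁻¹ *ᵥ v - θ * v ⬝ᵥ v) =
      θ / 2 * v ⬝ᵥ v + -(1 / 2) * (v ⬝ᵥ S⁻¹ *ᵥ v) by ring, Real.exp_add]
  have : √S.det ≠ 0 := by positivity
  field_simp

end GaussianDensity

/-! ### The joint Gaussian of [x; y], its disintegration and the mean square error -/

section BlockGaussian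

variable {n m : ℕ}

/-- The affine estimator `y ↦ mx + Kxy Ky⁻¹ (y - my)`. -/
def affineEstimator (mx : Fin n → ℝ) (my : Fin m → ℝ) (Kxy : Matrix (Fin n) (Fin m) ℝ)
    (Ky : Matrix (Fin m) (Fin m) ℝ) (y : Fin m → ℝ) : Fin n → ℝ :=
  mx + (Kxy * Ky⁻¹) *ᵥ (y - my)

/-- The covariance matrix of `[x; y]` when `y` has covariance `Ky`, the cross covariance is `Kxy`,
and the covariance of the error of the affine estimator is `P`. -/
def blockCovariance (P : Matrix (Fin n) (Fin n) ℝ) (Kxy : Matrix (Fin n) (Fin m) ℝ)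
    (Ky : Matrix (Fin m) (Fin m) ℝ) : Matrix (Fin n ⊕ Fin m) (Fin n ⊕ Fin m) ℝ :=
  fromBlocks (P + Kxy * Ky⁻¹ * Kxyᵀ) Kxy Kxyᵀ Ky

/-- The Gaussian density on `ℝⁿ × ℝᵐ` with covariance `blockCovariance P Kxy Ky`. -/
def blockGaussian (mx : Fin n → ℝ) (my : Fin m → ℝ) (P : Matrix (Fin n) (Fin n) ℝ)
    (Kxy : Matrix (Fin n) (Fin m) ℝ) (Ky : Matrix (Fin m) (Fin m) ℝ) :
    (Fin n ⊕ Fin m → ℝ) → ℝ :=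
  gaussianDensity (Sum.elim mx my) (blockCovariance P Kxy Ky)

variable (mx : Fin n → ℝ) (my : Fin m → ℝ) {P : Matrix (Fin n) (Fin n) ℝ}
  (Kxy : Matrix (Fin n) (Fin m) ℝ) {Ky : Matrix (Fin m) (Fin m) ℝ}

theorem continuous_affineEstimator : Continuous (affineEstimator mx my Kxy Ky) := by
  unfold affineEstimator
  fun_prop

theorem measurable_affineEstimator : Measurable (affineEstimator mx my Kxy Ky) :=
  (continuous_affineEstimator mx my Kxy).measurable

/-- The Schur complement of `Ky` in the block matrix is P, which is the reason for parametrizing the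
covariance by P instead of by its upper left block. -/
theorem det_blockCovariance (hKy : Ky.PosDef) :
    (blockCovariance P Kxy Ky).det = Ky.det * P.det := by
  have : Invertible Ky := hKy.isUnit.invertible
  rw [blockCovariance, det_fromBlocks₂₂, invOf_eq_nonsing_inv, add_sub_cancel_right]

theorem posDef_blockCovariance (hP : P.PosDef) (hKy : Ky.PosDef) :
    (blockCovariance P Kxy Ky).PosDef := by
  have : Invertible Ky := hKy.isUnit.invertible
  have hs : (blockCovariance P Kxy Ky).PosSemidef := by
    have h := (PosDef.fromBlocks₂₂ (P + Kxy * Ky⁻¹ * Kxyᵀ) Kxy hKy).2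
    rw [conjTranspose_eq_transpose_of_trivial, add_sub_cancel_right] at h
    exact h hP.posSemidef
  rw [hs.posDef_iff_det_ne_zero, det_blockCovariance Kxy hKy]
  exact mul_ne_zero hKy.det_pos.ne' hP.det_pos.ne'

/-- Completion of the square. The block inverse is never computed: `hsolve` exhibits the preimage of
[a; b] under the block matrix, found by elimination, and pairing it with [a; b] gives the two
squares. -/
theorem quadForm_inv_blockCovariance (hP : P.PosDef) (hKy : Ky.PosDef)
    (a : Fin n → ℝ) (b : Fin m → ℝ) :
    Sum.elim a b ⬝ᵥ ((blockCovariance P Kxy Ky)⁻¹ *ᵥ Sum.elim a b) =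
      (a - (Kxy * Ky⁻¹) *ᵥ b) ⬝ᵥ (P⁻¹ *ᵥ (a - (Kxy * Ky⁻¹) *ᵥ b)) + b ⬝ᵥ (Ky⁻¹ *ᵥ b) := by
  obtain ⟨e, he⟩ : ∃ e, e = a - (Kxy * Ky⁻¹) *ᵥ b := ⟨_, rfl⟩
  rw [← he]
  have hKyT : (Ky⁻¹)ᵀ = Ky⁻¹ := hKy.inv.isHermitian
  have hKinv : Ky * Ky⁻¹ = 1 := mul_nonsing_inv _ hKy.det_pos.ne'.isUnit
  have hsolve : Sum.elim a b = blockCovariance P Kxy Ky *ᵥ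
      Sum.elim (P⁻¹ *ᵥ e) (Ky⁻¹ *ᵥ b - (Ky⁻¹ * Kxyᵀ) *ᵥ (P⁻¹ *ᵥ e)) := by
    rw [blockCovariance, fromBlocks_mulVec]
    simp only [Sum.elim_comp_inl, Sum.elim_comp_inr]
    congr 1
    · simp only [mulVec_sub, mulVec_mulVec, ← Matrix.mul_assoc, Matrix.add_mul, add_mulVec,
        mul_nonsing_inv _ hP.det_pos.ne'.isUnit, one_mulVec]
      rw [he]
      abel
    · simp only [mulVec_sub, mulVec_mulVec, ← Matrix.mul_assoc, hKinv, one_mulVec, Matrix.one_mul]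
      abel
  have hinv : (blockCovariance P Kxy Ky)⁻¹ *ᵥ Sum.elim a b =
      Sum.elim (P⁻¹ *ᵥ e) (Ky⁻¹ *ᵥ b - (Ky⁻¹ * Kxyᵀ) *ᵥ (P⁻¹ *ᵥ e)) := by
    rw [hsolve, mulVec_mulVec,
      nonsing_inv_mul _ (posDef_blockCovariance Kxy hP hKy).det_pos.ne'.isUnit, one_mulVec]
  have hcross : b ⬝ᵥ ((Ky⁻¹ * Kxyᵀ) *ᵥ (P⁻¹ *ᵥ e)) = ((Kxy * Ky⁻¹) *ᵥ b) ⬝ᵥ (P⁻¹ *ᵥ e) := by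
    rw [dotProduct_mulVec, ← mulVec_transpose, transpose_mul, transpose_transpose, hKyT]
  rw [hinv, sumElim_dotProduct_sumElim, dotProduct_sub, hcross]
  have ha : a = e + (Kxy * Ky⁻¹) *ᵥ b := by rw [he, sub_add_cancel]
  rw [ha, add_dotProduct]
  ring

/-- The joint density is the product of the conditional and the marginal density. -/
theorem blockGaussian_sumElim (hP : P.PosDef) (hKy : Ky.PosDef) (x : Fin n → ℝ)
    (y : Fin m → ℝ) :
    blockGaussian mx my P Kxy Ky (Sum.elim x y) =
      gaussianDensity (affineEstimator mx my Kxy Ky y) P x * gaussianDensity my Ky y := by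
  have hsub : Sum.elim x y - Sum.elim mx my = Sum.elim (x - mx) (y - my) := by
    ext i; cases i <;> rfl
  have he : x - mx - (Kxy * Ky⁻¹) *ᵥ (y - my) = x - affineEstimator mx my Kxy Ky y := by
    rw [affineEstimator]; abel
  have h1 := hP.det_pos
  have h2 := hKy.det_pos
  unfold blockGaussian gaussianDensity
  rw [hsub, quadForm_inv_blockCovariance Kxy hP hKy, he, det_blockCovariance Kxy hKy, mul_add,
    Real.exp_add, Fintype.card_sum, pow_add,
    show (2 * Real.pi) ^ Fintype.card (Fin n) * (2 * Real.pi) ^ Fintype.card (Fin m) *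
      (Ky.det * P.det) = ((2 * Real.pi) ^ Fintype.card (Fin n) * P.det) *
      ((2 * Real.pi) ^ Fintype.card (Fin m) * Ky.det) by ring,
    Real.sqrt_mul (by positivity), mul_inv]
  ring

theorem measurable_blockGaussian : Measurable (blockGaussian mx my P Kxy Ky) :=
  measurable_gaussianDensity _ _

theorem isProbDensity_blockGaussian (hP : P.PosDef) (hKy : Ky.PosDef) :
    IsProbDensity (blockGaussian mx my P Kxy Ky) :=
  isProbDensity_gaussianDensity _ (posDef_blockCovariance Kxy hP hKy)

theorem lintegral_sumElim {F : (Fin n ⊕ Fin m → ℝ) → ℝ≥0∞} (hF : Measurable F) :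
    ∫⁻ z, F z = ∫⁻ y : Fin m → ℝ, ∫⁻ x : Fin n → ℝ, F (Sum.elim x y) := by
  have h := volume_measurePreserving_sumPiEquivProdPi_symm (fun _ : Fin n ⊕ Fin m => ℝ)
  have hF' : Measurable fun w : (Fin n → ℝ) × (Fin m → ℝ) =>
    F ((MeasurableEquiv.sumPiEquivProdPi fun _ : Fin n ⊕ Fin m => ℝ).symm w) :=
    hF.comp (MeasurableEquiv.measurable _)
  rw [← h.lintegral_comp hF, Measure.volume_eq_prod, lintegral_prod_symm' _ hF']
  refine lintegral_congr fun y => lintegral_congr fun x => congrArg F ?_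
  ext i; cases i <;> rfl

theorem measurable_sumElim_left (y : Fin m → ℝ) :
    Measurable fun x : Fin n → ℝ => (Sum.elim x y : Fin n ⊕ Fin m → ℝ) :=
  measurable_pi_lambda _ fun i => by
    cases i
    · exact measurable_eval_real _
    · exact measurable_const

theorem measurable_comp_inr : Measurable fun z : Fin n ⊕ Fin m → ℝ => z ∘ Sum.inr :=
  measurable_pi_lambda _ fun _ => measurable_eval_real _

theorem measurable_comp_inl : Measurable fun z : Fin n ⊕ Fin m → ℝ => z ∘ Sum.inl :=
  measurable_pi_lambda _ fun _ => measurable_eval_real _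

theorem measurable_predError {g : (Fin m → ℝ) → Fin n → ℝ} (hg : Measurable g) :
    Measurable (predError g) :=
  measurable_comp_inl.sub (hg.comp measurable_comp_inr)

theorem lintegral_blockGaussian (hP : P.PosDef) (hKy : Ky.PosDef)
    {F : (Fin n ⊕ Fin m → ℝ) → ℝ≥0∞} (hF : Measurable F) :
    ∫⁻ z, F z * ENNReal.ofReal (blockGaussian mx my P Kxy Ky z) =
      ∫⁻ y, (∫⁻ x, F (Sum.elim x y) *
        ENNReal.ofReal (gaussianDensity (affineEstimator mx my Kxy Ky y) P x)) *
        ENNReal.ofReal (gaussianDensity my Ky y) := by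
  have hm : Measurable fun z => F z * ENNReal.ofReal (blockGaussian mx my P Kxy Ky z) :=
    hF.mul (measurable_blockGaussian mx my Kxy).ennreal_ofReal
  rw [lintegral_sumElim hm]
  refine lintegral_congr fun y => ?_
  rw [← lintegral_mul_const]
  · refine lintegral_congr fun x => ?_
    rw [blockGaussian_sumElim mx my Kxy hP hKy, ENNReal.ofReal_mul (gaussianDensity_pos hP _ _).le,
      mul_assoc]
  · exact (hF.comp (measurable_sumElim_left y)).mul
      (measurable_gaussianDensity _ _).ennreal_ofReal

theorem measurable_dotProduct_self {α : Type*} [MeasurableSpace α] {k : ℕ} {f : α → Fin k → ℝ}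
    (hf : Measurable f) : Measurable fun a => f a ⬝ᵥ f a :=
  Finset.measurable_fun_sum _ fun i _ =>
    ((measurable_eval_real i).comp hf).mul ((measurable_eval_real i).comp hf)

/-- The mean square error splits into the variance part and the distance to the affine
estimator. -/
theorem cost_blockGaussian (hP : P.PosDef) (hKy : Ky.PosDef) {g : (Fin m → ℝ) → Fin n → ℝ}
    (hg : Measurable g) :
    cost (blockGaussian mx my P Kxy Ky) g =
      2⁻¹ * (ENNReal.ofReal P.trace +
        ∫⁻ y, ENNReal.ofReal ((affineEstimator mx my Kxy Ky y - g y) ⬝ᵥ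
          (affineEstimator mx my Kxy Ky y - g y)) *
            ENNReal.ofReal (gaussianDensity my Ky y)) := by
  have hm : Measurable fun z : Fin n ⊕ Fin m → ℝ =>
      ENNReal.ofReal (predError g z ⬝ᵥ predError g z) :=
    (measurable_dotProduct_self (measurable_predError hg)).ennreal_ofReal
  rw [cost, lintegral_blockGaussian mx my Kxy hP hKy hm]
  simp only [predError, Sum.elim_comp_inl, Sum.elim_comp_inr]
  simp_rw [lintegral_dotProduct_gaussianDensity _ _ hP,
    ENNReal.ofReal_add hP.posSemidef.trace_nonneg (dotProduct_self_nonneg _), add_mul]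
  rw [lintegral_add_left ((measurable_gaussianDensity _ _).ennreal_ofReal.const_mul _),
    lintegral_const_mul _ (measurable_gaussianDensity _ _).ennreal_ofReal,
    (isProbDensity_gaussianDensity my hKy).lintegral_eq_one, mul_one]

theorem cost_blockGaussian_affineEstimator (hP : P.PosDef) (hKy : Ky.PosDef) :
    cost (blockGaussian mx my P Kxy Ky) (affineEstimator mx my Kxy Ky) =
      2⁻¹ * ENNReal.ofReal P.trace := by
  rw [cost_blockGaussian mx my Kxy hP hKy (measurable_affineEstimator mx my Kxy)]
  simp

/-- The excess cost is a mean squared distance to the affine estimator. That estimator does not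
involve P, so the bound serves the tilted density as well as the nominal one. -/
theorem cost_affineEstimator_le (hP : P.PosDef) (hKy : Ky.PosDef) {g : (Fin m → ℝ) → Fin n → ℝ}
    (hg : Measurable g) :
    cost (blockGaussian mx my P Kxy Ky) (affineEstimator mx my Kxy Ky) ≤
      cost (blockGaussian mx my P Kxy Ky) g := by
  rw [cost_blockGaussian_affineEstimator mx my Kxy hP hKy, cost_blockGaussian mx my Kxy hP hKy hg]
  gcongr
  exact le_self_add

/-- The trace term is finite and cancels, so the mean squared distance to the affine estimator is
zero. The density of y is positive everywhere, which turns this into equality up to Lebesgue-null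
sets. -/
theorem ae_eq_affineEstimator_of_cost_le (hP : P.PosDef) (hKy : Ky.PosDef)
    {g : (Fin m → ℝ) → Fin n → ℝ} (hg : Measurable g)
    (h : cost (blockGaussian mx my P Kxy Ky) g ≤
      cost (blockGaussian mx my P Kxy Ky) (affineEstimator mx my Kxy Ky)) :
    g =ᵐ[volume] affineEstimator mx my Kxy Ky := by
  rw [cost_blockGaussian_affineEstimator mx my Kxy hP hKy, cost_blockGaussian mx my Kxy hP hKy hg,
    ENNReal.mul_le_mul_iff_right (by simp) (by simp)] at h
  have h0 := (ENNReal.add_le_add_iff_left ENNReal.ofReal_ne_top).1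
    (h.trans_eq (add_zero _).symm)
  rw [nonpos_iff_eq_zero, lintegral_eq_zero_iff] at h0
  · filter_upwards [h0] with y hy
    have hpos := gaussianDensity_pos hKy my y
    simp only [Pi.zero_apply, mul_eq_zero, ENNReal.ofReal_eq_zero, hpos.not_ge, or_false] at hy
    have := dotProduct_self_eq_zero.1 (le_antisymm hy (dotProduct_self_nonneg _))
    exact (sub_eq_zero.1 this).symm
  · exact (measurable_dotProduct_self
      ((measurable_affineEstimator mx my Kxy).sub hg)).ennreal_ofReal.mul
        (measurable_gaussianDensity _ _).ennreal_ofReal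

theorem gaussianDensity_eq_sub {ι : Type} [Fintype ι] [DecidableEq ι] (μ z : ι → ℝ)
    (S : Matrix ι ι ℝ) : gaussianDensity μ S z = gaussianDensity 0 S (z - μ) := by
  simp [gaussianDensity]

/-- The error of the affine estimator is centered Gaussian with covariance `P`. -/
theorem map_predError_blockGaussian (hP : P.PosDef) (hKy : Ky.PosDef) :
    (densityMeasure (blockGaussian mx my P Kxy Ky)).map
      (predError (affineEstimator mx my Kxy Ky)) = densityMeasure (gaussianDensity 0 P) := by
  have hm := measurable_predError (measurable_affineEstimator mx my Kxy (Ky := Ky))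
  refine Measure.ext_of_lintegral _ fun F hF => ?_
  rw [lintegral_map hF hm, lintegral_densityMeasure (measurable_gaussianDensity _ _) hF,
    lintegral_densityMeasure (measurable_blockGaussian mx my Kxy)
      (show Measurable fun z => F (predError _ z) from hF.comp hm)]
  refine (lintegral_blockGaussian mx my Kxy hP hKy
    (show Measurable fun z => F (predError _ z) from hF.comp hm)).trans ?_
  simp only [predError, Sum.elim_comp_inl, Sum.elim_comp_inr]
  have h1 : ∀ y, ∫⁻ x, F (x - affineEstimator mx my Kxy Ky y) *
      ENNReal.ofReal (gaussianDensity (affineEstimator mx my Kxy Ky y) P x) =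
      ∫⁻ x, F x * ENNReal.ofReal (gaussianDensity 0 P x) := by
    intro y
    rw [← lintegral_sub_right_eq_self (fun x => F x * ENNReal.ofReal (gaussianDensity 0 P x))
      (affineEstimator mx my Kxy Ky y)]
    simp_rw [← gaussianDensity_eq_sub]
  simp_rw [h1]
  rw [lintegral_const_mul _ (measurable_gaussianDensity _ _).ennreal_ofReal,
    (isProbDensity_gaussianDensity my hKy).lintegral_eq_one, mul_one]

theorem hasErrorCovariance_blockGaussian (hP : P.PosDef) (hKy : Ky.PosDef) :
    HasErrorCovariance (blockGaussian mx my P Kxy Ky) (affineEstimator mx my Kxy Ky) P := by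
  have hm := measurable_predError (measurable_affineEstimator mx my Kxy (Ky := Ky))
  constructor
  · intro i
    have := memLp_eval_gaussianDensity 0 hP i
    rw [← map_predError_blockGaussian mx my Kxy hP hKy,
      memLp_map_measure_iff (measurable_eval_real i).aestronglyMeasurable hm.aemeasurable] at this
    exact this
  · intro i j
    rw [← covariance_eval_gaussianDensity 0 hP i j, ← map_predError_blockGaussian mx my Kxy hP hKy,
      covariance_map_fun (measurable_eval_real i).aestronglyMeasurable
        (measurable_eval_real j).aestronglyMeasurable hm.aemeasurable]

theorem condDensity_blockGaussian (hP : P.PosDef) (hKy : Ky.PosDef) (y : Fin m → ℝ) :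
    condDensity (blockGaussian mx my P Kxy Ky) y =
      gaussianDensity (affineEstimator mx my Kxy Ky y) P := by
  ext x
  simp only [condDensity, blockGaussian_sumElim mx my Kxy hP hKy]
  rw [integral_mul_const, integral_gaussianDensity _ hP, one_mul,
    mul_div_cancel_right₀ _ (gaussianDensity_pos hKy _ _).ne']

/-- Tilting by the squared error of the affine estimator changes the error covariance `P` to
`(P⁻¹ - θ)⁻¹`. -/
theorem blockGaussian_tilt (hP : P.PosDef) (hKy : Ky.PosDef) {θ : ℝ}
    (hθ : (P⁻¹ - θ • 1).PosDef) (z : Fin n ⊕ Fin m → ℝ) :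
    blockGaussian mx my (P⁻¹ - θ • 1)⁻¹ Kxy Ky z =
      Real.exp (θ / 2 * (predError (affineEstimator mx my Kxy Ky) z ⬝ᵥ
        predError (affineEstimator mx my Kxy Ky) z) + 1 / 2 * Real.log (1 - θ • P).det) *
        blockGaussian mx my P Kxy Ky z := by
  obtain ⟨x, y, rfl⟩ : ∃ x y, z = Sum.elim x y :=
    ⟨z ∘ Sum.inl, z ∘ Sum.inr, (Sum.elim_comp_inl_inr z).symm⟩
  rw [blockGaussian_sumElim mx my Kxy hθ.inv hKy, blockGaussian_sumElim mx my Kxy hP hKy,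
    ← exp_mul_gaussianDensity _ _ hP hθ]
  simp only [predError, Sum.elim_comp_inl, Sum.elim_comp_inr]
  ring

end BlockGaussian

/-! ### Exponential tilting and the Gibbs variational principle -/

section Tilting

open InformationTheory

variable {α : Type*} [MeasurableSpace α] {μ ν : Measure α} {φ : α → ℝ}

/-- Fenchel–Young inequality for the convex function r log r, with 1 to spare; it comes from log u ≤
u - 1 at u = exp b / r. -/
theorem mul_le_klFun_add_exp {r : ℝ} (hr : 0 ≤ r) (b : ℝ) :
    r * b ≤ klFun r + Real.exp b := by
  rw [klFun_apply]
  rcases hr.eq_or_lt with rfl | hr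
  · have := Real.exp_pos b
    simp; linarith
  · have h := Real.log_le_sub_one_of_pos (div_pos (Real.exp_pos b) hr)
    rw [Real.log_div (Real.exp_pos b).ne' hr.ne', Real.log_exp] at h
    have h2 := mul_le_mul_of_nonneg_left h hr.le
    rw [mul_sub, mul_sub, mul_div_cancel₀ _ hr.ne'] at h2
    linarith

/-- A function with finite exponential moment under `ν` is integrable under every measure with
finite divergence from `ν`. -/
theorem integrable_of_klDiv_ne_top [IsFiniteMeasure μ] [IsFiniteMeasure ν] (hφ : Measurable φ)
    (hφ0 : ∀ x, 0 ≤ φ x) (hexp : Integrable (fun x => Real.exp (φ x)) ν) (h : klDiv μ ν ≠ ∞) :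
    Integrable φ μ := by
  have hac := (klDiv_ne_top_iff.1 h).1
  refine ⟨hφ.aestronglyMeasurable, ?_⟩
  rw [hasFiniteIntegral_iff_ofReal (ae_of_all _ hφ0),
    ← lintegral_rnDeriv_mul hac hφ.ennreal_ofReal.aemeasurable]
  -- Fenchel–Young pointwise, with r the density of μ with respect to ν and b = φ x.
  calc ∫⁻ x, μ.rnDeriv ν x * ENNReal.ofReal (φ x) ∂ν
      ≤ ∫⁻ x, (ENNReal.ofReal (klFun (μ.rnDeriv ν x).toReal) +
          ENNReal.ofReal (Real.exp (φ x))) ∂ν := by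
        refine lintegral_mono_ae ?_
        filter_upwards [Measure.rnDeriv_lt_top μ ν] with x hx
        rw [← ENNReal.ofReal_add (klFun_nonneg ENNReal.toReal_nonneg) (Real.exp_pos _).le]
        nth_rw 1 [← ENNReal.ofReal_toReal hx.ne]
        rw [← ENNReal.ofReal_mul ENNReal.toReal_nonneg]
        exact ENNReal.ofReal_le_ofReal (mul_le_klFun_add_exp ENNReal.toReal_nonneg _)
    _ = klDiv μ ν + ∫⁻ x, ENNReal.ofReal (Real.exp (φ x)) ∂ν := by
        rw [lintegral_add_right _ hφ.exp.ennreal_ofReal, klDiv_eq_lintegral_klFun_of_ac hac]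
    _ < ∞ := ENNReal.add_lt_top.2 ⟨h.lt_top,
        (hasFiniteIntegral_iff_ofReal (ae_of_all _ fun x => (Real.exp_pos _).le)).1 hexp.2⟩

/-- The density of ν.tilted φ with respect to ν is exp φ / Z with Z = ∫ exp φ dν, so the
log-likelihood ratios of μ against ν and against ν.tilted φ differ by φ - log Z. -/
theorem toReal_klDiv_eq_add_tilted [IsProbabilityMeasure μ] [IsProbabilityMeasure ν]
    (hφμ : Integrable φ μ) (hexp : Integrable (fun x => Real.exp (φ x)) ν)
    (h : klDiv μ ν ≠ ∞) :
    klDiv μ (ν.tilted φ) ≠ ∞ ∧ (klDiv μ ν).toReal = (klDiv μ (ν.tilted φ)).toReal +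
      ∫ x, φ x ∂μ - Real.log (∫ x, Real.exp (φ x) ∂ν) := by
  obtain ⟨hac, hint⟩ := klDiv_ne_top_iff.1 h
  have := isProbabilityMeasure_tilted hexp
  have hac' : μ ≪ ν.tilted φ := hac.trans (absolutelyContinuous_tilted hexp)
  refine ⟨klDiv_ne_top hac' (integrable_llr_tilted_right hac hφμ hint hexp), ?_⟩
  rw [toReal_klDiv_of_measure_eq hac (by simp), toReal_klDiv_of_measure_eq hac' (by simp),
    integral_llr_tilted_right hac hφμ hexp hint]
  ring

theorem toReal_klDiv_tilted [IsProbabilityMeasure ν]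
    (hexp : Integrable (fun x => Real.exp (φ x)) ν) (hφ : Integrable φ (ν.tilted φ))
    (hφm : Measurable φ) :
    klDiv (ν.tilted φ) ν ≠ ∞ ∧ (klDiv (ν.tilted φ) ν).toReal =
      ∫ x, φ x ∂(ν.tilted φ) - Real.log (∫ x, Real.exp (φ x) ∂ν) := by
  have := isProbabilityMeasure_tilted hexp
  have hac := tilted_absolutelyContinuous ν φ
  have hllr : llr (ν.tilted φ) ν =ᵐ[ν.tilted φ]
      fun x => φ x - Real.log (∫ x, Real.exp (φ x) ∂ν) := by
    refine hac.ae_le ?_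
    filter_upwards [llr_tilted_left Measure.AbsolutelyContinuous.rfl hexp hφm.aemeasurable,
      llr_self ν] with x h1 h2
    rw [h1, h2]; simp
  have hint : Integrable (llr (ν.tilted φ) ν) (ν.tilted φ) :=
    (hφ.sub (integrable_const _)).congr hllr.symm
  refine ⟨klDiv_ne_top hac hint, ?_⟩
  rw [toReal_klDiv_of_measure_eq hac (by simp), integral_congr_ae hllr,
    integral_sub hφ (integrable_const _)]
  simp

/-- Among the measures in a divergence ball around `ν` that has `ν.tilted φ` on its boundary, the
integral of `φ` is maximized by `ν.tilted φ` only. -/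
theorem integral_le_integral_tilted [IsProbabilityMeasure μ] [IsProbabilityMeasure ν]
    (hφm : Measurable φ) (hexp : Integrable (fun x => Real.exp (φ x)) ν)
    (hφ : Integrable φ (ν.tilted φ)) (hφμ : Integrable φ μ)
    (h : klDiv μ ν ≤ klDiv (ν.tilted φ) ν) :
    ∫ x, φ x ∂μ ≤ ∫ x, φ x ∂(ν.tilted φ) ∧
      (∫ x, φ x ∂(ν.tilted φ) ≤ ∫ x, φ x ∂μ → μ = ν.tilted φ) := by
  have := isProbabilityMeasure_tilted hexp
  obtain ⟨ht, hte⟩ := toReal_klDiv_tilted hexp hφ hφm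
  obtain ⟨hμ, hμe⟩ := toReal_klDiv_eq_add_tilted hφμ hexp (ne_top_of_le_ne_top ht h)
  have hle := ENNReal.toReal_mono ht h
  have h0 : 0 ≤ (klDiv μ (ν.tilted φ)).toReal := ENNReal.toReal_nonneg
  -- Subtracting `hμe` from `hte`, log Z cancels: the gap between the two integrals of φ is at least
  -- the divergence of μ from the tilted measure. Equality forces that divergence to vanish.
  refine ⟨by linarith, fun hge => klDiv_eq_zero_iff.1 ?_⟩
  have h1 : (klDiv μ (ν.tilted φ)).toReal = 0 := by linarith
  exact ((ENNReal.toReal_eq_zero_iff _).1 h1).resolve_right hμ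

variable {ι : Type} [Fintype ι]

/-- Since q and q' both have total mass one, the constant a is forced to be minus the log of the
normalizing integral. -/
theorem tilted_densityMeasure {q q' : (ι → ℝ) → ℝ} (hq : IsProbDensity q)
    (hq' : IsProbDensity q') {φ : (ι → ℝ) → ℝ} (hφ : Measurable φ) {a : ℝ}
    (h : ∀ z, q' z = Real.exp (φ z + a) * q z) :
    Integrable (fun z => Real.exp (φ z)) (densityMeasure q) ∧
      ∫ z, Real.exp (φ z) ∂densityMeasure q = Real.exp (-a) ∧
      (densityMeasure q).tilted φ = densityMeasure q' := by
  have hlin : ∫⁻ z, ENNReal.ofReal (Real.exp (φ z)) ∂densityMeasure q =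
      ENNReal.ofReal (Real.exp (-a)) := by
    rw [lintegral_densityMeasure hq.measurable hφ.exp.ennreal_ofReal, ← mul_one
      (ENNReal.ofReal (Real.exp (-a))), ← hq'.lintegral_eq_one,
      ← lintegral_const_mul _ hq'.measurable.ennreal_ofReal]
    refine lintegral_congr fun z => ?_
    rw [← ENNReal.ofReal_mul (Real.exp_pos _).le, ← ENNReal.ofReal_mul (Real.exp_pos _).le, h z,
      ← mul_assoc, ← Real.exp_add]
    ring_nf
  have hint : ∫ z, Real.exp (φ z) ∂densityMeasure q = Real.exp (-a) := by
    rw [integral_eq_lintegral_of_nonneg_ae (ae_of_all _ fun z => (Real.exp_pos _).le)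
      hφ.exp.aestronglyMeasurable, hlin, ENNReal.toReal_ofReal (Real.exp_pos _).le]
  refine ⟨⟨hφ.exp.aestronglyMeasurable, ?_⟩, hint, ?_⟩
  · rw [hasFiniteIntegral_iff_ofReal (ae_of_all _ fun z => (Real.exp_pos _).le), hlin]
    exact ENNReal.ofReal_lt_top
  · rw [Measure.tilted, hint, densityMeasure, densityMeasure,
      ← withDensity_mul _ hq.measurable.ennreal_ofReal (by fun_prop)]
    congr 1
    ext z
    rw [Pi.mul_apply, ← ENNReal.ofReal_mul (hq.nonneg z), h z, Real.exp_add, Real.exp_neg,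
      div_inv_eq_mul]
    ring_nf

theorem ae_eq_of_densityMeasure_eq {q q' : (ι → ℝ) → ℝ} (hq : IsProbDensity q)
    (hq' : IsProbDensity q') (h : densityMeasure q = densityMeasure q') : q =ᵐ[volume] q' := by
  have := (withDensity_eq_iff hq.measurable.ennreal_ofReal.aemeasurable
    hq'.measurable.ennreal_ofReal.aemeasurable (by simp [hq.lintegral_eq_one])).1 h
  filter_upwards [this] with z hz
  exact (ENNReal.ofReal_eq_ofReal_iff (hq.nonneg z) (hq'.nonneg z)).1 hz

variable [DecidableEq ι]

/-- Densities with finite divergence from a Gaussian have finite second moments. -/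
theorem memLp_eval_sub_of_mem_klBall {μ : ι → ℝ} {S : Matrix ι ι ℝ} (hS : S.PosDef) {ε : ℝ}
    (hε : 0 < ε) (hSε : (S⁻¹ - ε • 1).PosDef) {c : ℝ} {q : (ι → ℝ) → ℝ}
    (hq : q ∈ klBall (gaussianDensity μ S) c) (i : ι) :
    MemLp (fun z => z i - μ i) 2 (densityMeasure q) := by
  have hp := isProbDensity_gaussianDensity μ hS
  have := hp.isProbabilityMeasure
  have := hq.1.isProbabilityMeasure
  have hφm : Measurable fun z : ι → ℝ => ε / 2 * ((z - μ) ⬝ᵥ (z - μ)) := by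
    unfold dotProduct; fun_prop
  -- Tilting by ε gives another Gaussian density, so the squared distance to μ has a finite
  -- exponential moment under the center of the ball.
  obtain ⟨hexp, -, -⟩ := tilted_densityMeasure hp (isProbDensity_gaussianDensity μ hSε.inv) hφm
    fun z => (exp_mul_gaussianDensity μ z hS hSε).symm
  have hint := integrable_of_klDiv_ne_top (μ := densityMeasure q) hφm
    (fun z => mul_nonneg (by positivity) (dotProduct_self_nonneg _)) hexp
    (ne_top_of_le_ne_top ENNReal.ofReal_ne_top hq.2)
  rw [memLp_two_iff_integrable_sq ((measurable_eval_real i).sub_const _).aestronglyMeasurable]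
  refine (hint.const_mul (2 / ε)).mono'
    (((measurable_eval_real i).sub_const _).pow_const 2).aestronglyMeasurable
    (ae_of_all _ fun z => ?_)
  rw [Real.norm_of_nonneg (sq_nonneg _), ← mul_assoc, div_mul_div_cancel₀ hε.ne',
    div_self two_ne_zero, one_mul, pow_two]
  exact Finset.single_le_sum (f := fun i => (z - μ) i * (z - μ) i)
    (fun i _ => mul_self_nonneg _) (Finset.mem_univ i)

end Tilting

/-! ### Spectral calculus for I - θP and the function γ -/

section Spectral

variable {ι : Type} [Fintype ι] [DecidableEq ι] {P : Matrix ι ι ℝ}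

theorem Matrix.IsHermitian.smul_one_add_smul_eq (hP : P.IsHermitian) (a b : ℝ) :
    a • 1 + b • P = (hP.eigenvectorUnitary : Matrix ι ι ℝ) *
      diagonal (fun i => a + b * hP.eigenvalues i) *
      star (hP.eigenvectorUnitary : Matrix ι ι ℝ) := by
  have h := hP.spectral_theorem
  rw [Unitary.conjStarAlgAut_apply] at h
  have hd : diagonal (fun i => a + b * hP.eigenvalues i) =
      a • (1 : Matrix ι ι ℝ) + b • diagonal (RCLike.ofReal ∘ hP.eigenvalues) := by
    ext i j
    by_cases hij : i = j <;> simp [hij]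
  rw [hd, mul_add, add_mul, mul_smul_comm, mul_smul_comm, smul_mul_assoc, smul_mul_assoc, mul_one,
    Unitary.mul_star_self_of_mem hP.eigenvectorUnitary.2, ← h]

theorem Matrix.IsHermitian.posDef_smul_one_add_smul_iff (hP : P.IsHermitian) (a b : ℝ) :
    (a • 1 + b • P).PosDef ↔ ∀ i, 0 < a + b * hP.eigenvalues i := by
  rw [hP.smul_one_add_smul_eq, IsUnit.posDef_star_right_conjugate_iff
    (Unitary.isUnit_coe (U := hP.eigenvectorUnitary)), posDef_diagonal_iff]

theorem Matrix.IsHermitian.det_smul_one_add_smul (hP : P.IsHermitian) (a b : ℝ) :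
    (a • 1 + b • P).det = ∏ i, (a + b * hP.eigenvalues i) := by
  rw [hP.smul_one_add_smul_eq, det_mul_right_comm,
    Unitary.mul_star_self_of_mem hP.eigenvectorUnitary.2, one_mul, det_diagonal]

theorem Matrix.IsHermitian.trace_inv_smul_one_add_smul (hP : P.IsHermitian) {a b : ℝ}
    (h : ∀ i, a + b * hP.eigenvalues i ≠ 0) :
    (a • 1 + b • P)⁻¹.trace = ∑ i, (a + b * hP.eigenvalues i)⁻¹ := by
  have hinv : (a • 1 + b • P)⁻¹ = (hP.eigenvectorUnitary : Matrix ι ι ℝ) *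
      diagonal (fun i => (a + b * hP.eigenvalues i)⁻¹) *
      star (hP.eigenvectorUnitary : Matrix ι ι ℝ) := by
    refine inv_eq_right_inv ?_
    rw [hP.smul_one_add_smul_eq, mul_assoc, mul_assoc, ← mul_assoc (star _), ← mul_assoc (star _),
      Unitary.coe_star_mul_self, one_mul, ← mul_assoc (diagonal _), diagonal_mul_diagonal]
    simp [h]
  rw [hinv, trace_mul_cycle, Unitary.coe_star_mul_self, one_mul, trace_diagonal]

/-- Any positive ε below all the eigenvalues works. Applied to an inverse covariance, it provides
the exponential moment that `memLp_eval_sub_of_mem_klBall` requires. -/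
theorem Matrix.PosDef.exists_sub_smul_one (hP : P.PosDef) :
    ∃ ε : ℝ, 0 < ε ∧ (P - ε • 1).PosDef := by
  have h : ∀ᶠ ε in nhdsWithin (0 : ℝ) (Set.Ioi 0), ∀ i, ε < hP.isHermitian.eigenvalues i :=
    Filter.eventually_all.2 fun i =>
      (Ioo_mem_nhdsGT (hP.eigenvalues_pos i)) |> Filter.mem_of_superset <| fun ε hε => hε.2
  obtain ⟨ε, hε, hε0⟩ := (h.and self_mem_nhdsWithin).exists
  refine ⟨ε, hε0, ?_⟩
  have := (hP.isHermitian.posDef_smul_one_add_smul_iff (-ε) 1).2 fun i => by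
    have := hε i; linarith
  rwa [one_smul, neg_smul, neg_add_eq_sub] at this

/-- `v - 1 - log v` is strictly increasing on `[1, ∞)`. -/
theorem strictMonoOn_sub_one_sub_log :
    StrictMonoOn (fun v : ℝ => v - 1 - Real.log v) (Set.Ici 1) := by
  intro v hv w hw hvw
  have hv : 1 ≤ v := hv
  have h0 : 0 < v := by linarith
  have h1 : 1 < w / v := (one_lt_div h0).2 hvw
  -- log w - log v < w/v - 1 = (w - v)/v ≤ w - v, the last step because v ≥ 1.
  have h := Real.log_lt_sub_one_of_pos (by positivity) h1.ne'
  rw [Real.log_div (by linarith) h0.ne'] at h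
  have h2 : w / v - 1 ≤ w - v := by
    rw [div_sub_one h0.ne', div_le_iff₀ h0]
    nlinarith
  simp only
  linarith

/-- From log v = 2 log √v ≤ 2(√v - 1). The explicit lower bound shows where γ has passed a
prescribed level. -/
theorem sq_sqrt_sub_one_le {v : ℝ} (hv : 0 < v) : (√v - 1) ^ 2 ≤ v - 1 - Real.log v := by
  have h := Real.log_le_sub_one_of_pos (Real.sqrt_pos.2 hv)
  rw [Real.log_sqrt hv.le] at h
  have := Real.sq_sqrt hv.le
  nlinarith

variable {n : ℕ} {P : Matrix (Fin n) (Fin n) ℝ}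

theorem posDef_one_sub_smul_iff (hP : P.IsHermitian) (θ : ℝ) :
    (1 - θ • P).PosDef ↔ ∀ i, 0 < 1 - θ * hP.eigenvalues i := by
  have := hP.posDef_smul_one_add_smul_iff 1 (-θ)
  simpa [← sub_eq_add_neg] using this

/-- In an eigenbasis of P, γ is half the sum of v - 1 - log v over v = 1/(1 - θλ), with λ running
through the eigenvalues; monotonicity and growth can then be read off term by term. -/
theorem gammaFun_eq_sum (hP : P.IsHermitian) {θ : ℝ} (h : ∀ i, 0 < 1 - θ * hP.eigenvalues i) :
    gammaFun P θ = 1 / 2 * ∑ i, ((1 - θ * hP.eigenvalues i)⁻¹ - 1 -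
      Real.log (1 - θ * hP.eigenvalues i)⁻¹) := by
  have h1 := hP.det_smul_one_add_smul 1 (-θ)
  have h2 := hP.trace_inv_smul_one_add_smul (a := 1) (b := -θ)
    fun i => by have := h i; linarith
  simp only [one_smul, neg_smul, ← sub_eq_add_neg, neg_mul] at h1 h2
  rw [gammaFun, h1, trace_sub, h2, Real.log_prod fun i _ => (h i).ne', trace_one]
  simp only [Real.log_inv, Finset.sum_sub_distrib, Finset.sum_neg_distrib]
  simp
  ring

theorem strictMonoOn_gammaFun (hn : 0 < n) (hP : P.PosDef) {θ₁ θ₂ : ℝ} (h₁ : 0 ≤ θ₁)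
    (h₂ : (1 - θ₂ • P).PosDef) (h : θ₁ < θ₂) : gammaFun P θ₁ < gammaFun P θ₂ := by
  have hP' := hP.isHermitian
  rw [posDef_one_sub_smul_iff hP'] at h₂
  have hlt : ∀ i, 1 - θ₂ * hP'.eigenvalues i < 1 - θ₁ * hP'.eigenvalues i := fun i => by
    have := mul_lt_mul_of_pos_right h (hP.eigenvalues_pos i)
    linarith
  have h₁' : ∀ i, 0 < 1 - θ₁ * hP'.eigenvalues i := fun i => (h₂ i).trans (hlt i)
  rw [gammaFun_eq_sum hP' h₁', gammaFun_eq_sum hP' h₂]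
  have : Nonempty (Fin n) := ⟨⟨0, hn⟩⟩
  refine mul_lt_mul_of_pos_left (Finset.sum_lt_sum_of_nonempty Finset.univ_nonempty fun i _ => ?_)
    (by norm_num)
  have hone : ∀ θ, 0 ≤ θ → 0 < 1 - θ * hP'.eigenvalues i → 1 ≤ (1 - θ * hP'.eigenvalues i)⁻¹ :=
    fun θ hθ hpos => (one_le_inv₀ hpos).2 (by
      have := mul_nonneg hθ (hP.eigenvalues_pos i).le
      linarith)
  exact strictMonoOn_sub_one_sub_log (hone _ h₁ (h₁' i)) (hone _ (h₁.trans h.le) (h₂ i))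
    ((inv_lt_inv₀ (h₁' i) (h₂ i)).2 (hlt i))

theorem existsUnique_gammaFun_eq (hn : 0 < n) (hP : P.PosDef) {c : ℝ} (hc : 0 < c) :
    ∃! θ : ℝ, 0 < θ ∧ (1 - θ • P).PosDef ∧ gammaFun P θ = c := by
  have hP' := hP.isHermitian
  have hne : Nonempty (Fin n) := ⟨⟨0, hn⟩⟩
  obtain ⟨k, hk⟩ := Finite.exists_max hP'.eigenvalues
  have hkpos := hP.eigenvalues_pos k
  -- Chosen so that (√v - 1)² = 2c. With θ₁ defined by 1/(1 - θ₁λ) = v for the largest eigenvalue λ,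
  -- that single term of the sum is already at least 2c, and the other terms are nonnegative.
  set v : ℝ := (1 + √(2 * c)) ^ 2 with hv
  have hs : 0 ≤ √(2 * c) := Real.sqrt_nonneg _
  have hv1 : 1 ≤ v := by rw [hv]; nlinarith
  set θ₁ : ℝ := (1 - v⁻¹) / hP'.eigenvalues k with hθ₁
  have hvinv : v⁻¹ ≤ 1 := inv_le_one_of_one_le₀ hv1
  have hvpos : 0 < v⁻¹ := by positivity
  have hθ₁0 : 0 ≤ θ₁ := div_nonneg (by linarith) hkpos.le
  have hkθ : 1 - θ₁ * hP'.eigenvalues k = v⁻¹ := by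
    rw [hθ₁, div_mul_cancel₀ _ hkpos.ne']; ring
  have hpos : ∀ θ ∈ Set.Icc 0 θ₁, ∀ i, 0 < 1 - θ * hP'.eigenvalues i := by
    intro θ hθ i
    have : θ * hP'.eigenvalues i ≤ θ₁ * hP'.eigenvalues k :=
      mul_le_mul hθ.2 (hk i) (hP.eigenvalues_pos i).le hθ₁0
    linarith
  have hcont : ContinuousOn (gammaFun P) (Set.Icc 0 θ₁) := by
    refine ContinuousOn.congr (f := fun θ => 1 / 2 * ∑ i, ((1 - θ * hP'.eigenvalues i)⁻¹ - 1 -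
      Real.log (1 - θ * hP'.eigenvalues i)⁻¹)) ?_ fun θ hθ => gammaFun_eq_sum hP' (hpos θ hθ)
    refine continuousOn_const.mul (continuousOn_finsetSum _ fun i _ => ?_)
    have hinv : ContinuousOn (fun θ : ℝ => (1 - θ * hP'.eigenvalues i)⁻¹) (Set.Icc 0 θ₁) :=
      ContinuousOn.inv₀ (by fun_prop) fun θ hθ => (hpos θ hθ i).ne'
    exact (hinv.sub continuousOn_const).sub
      (hinv.log fun θ hθ => (inv_pos.2 (hpos θ hθ i)).ne')
  have h0 : gammaFun P 0 = 0 := by simp [gammaFun]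
  have h1 : c ≤ gammaFun P θ₁ := by
    have hp1 := hpos θ₁ ⟨hθ₁0, le_rfl⟩
    rw [gammaFun_eq_sum hP' hp1]
    have hterm : 2 * c ≤ (1 - θ₁ * hP'.eigenvalues k)⁻¹ - 1 -
        Real.log (1 - θ₁ * hP'.eigenvalues k)⁻¹ := by
      rw [hkθ, inv_inv]
      refine le_trans (le_of_eq ?_) (sq_sqrt_sub_one_le (by linarith))
      rw [hv, Real.sqrt_sq (by linarith), add_sub_cancel_left, Real.sq_sqrt (by linarith)]
    have := Finset.single_le_sum (f := fun i => (1 - θ₁ * hP'.eigenvalues i)⁻¹ - 1 -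
      Real.log (1 - θ₁ * hP'.eigenvalues i)⁻¹)
      (fun i _ => (sq_nonneg _).trans (sq_sqrt_sub_one_le (inv_pos.2 (hp1 i))))
      (Finset.mem_univ k)
    linarith
  obtain ⟨θ, hθ, hθc⟩ := intermediate_value_Icc hθ₁0 hcont ⟨h0.trans_le hc.le, h1⟩
  have hθpos : 0 < θ := hθ.1.lt_of_ne fun h => hc.ne (by rw [← hθc, ← h, h0])
  refine ⟨θ, ⟨hθpos, (posDef_one_sub_smul_iff hP' θ).2 (hpos θ hθ), hθc⟩, ?_⟩
  rintro θ' ⟨hθ'0, hθ', hθ'c⟩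
  rcases lt_trichotomy θ θ' with h | h | h
  · exact absurd (strictMonoOn_gammaFun hn hP hθpos.le hθ' h) (by rw [hθc, hθ'c]; exact lt_irrefl c)
  · exact h.symm
  · exact absurd (strictMonoOn_gammaFun hn hP hθ'0.le
      ((posDef_one_sub_smul_iff hP' θ).2 (hpos θ hθ)) h) (by rw [hθc, hθ'c]; exact lt_irrefl c)

/-- P⁻¹ - θI = (I - θP) P⁻¹ (I - θP) + θ(I - θP), a positive definite matrix plus a positive
semidefinite one. -/
theorem posDef_inv_sub_smul_one (hP : P.PosDef) {θ : ℝ} (hθ0 : 0 ≤ θ)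
    (hθ : (1 - θ • P).PosDef) : (P⁻¹ - θ • 1).PosDef := by
  have h := (hP.inv.conjTranspose_mul_mul_same
    (mulVec_injective_of_isUnit hθ.isUnit)).add_posSemidef (hθ.posSemidef.smul hθ0)
  have heq : (1 - θ • P)ᴴ * P⁻¹ * (1 - θ • P) + θ • (1 - θ • P) = P⁻¹ - θ • 1 := by
    have h1 : P⁻¹ * P = 1 := nonsing_inv_mul _ hP.det_pos.ne'.isUnit
    have h2 : P * P⁻¹ = 1 := mul_nonsing_inv _ hP.det_pos.ne'.isUnit
    rw [hθ.isHermitian.eq, Matrix.mul_assoc, mul_sub P⁻¹, Matrix.mul_one, mul_smul_comm, h1,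
      sub_mul, Matrix.one_mul, smul_mul_assoc, mul_sub P, h2, mul_smul_comm, Matrix.mul_one, sub_add_cancel]
  rwa [heq] at h

/-- The right side is ∫ φ dν_φ - log Z for φ = θ/2 ‖e‖², that is, the divergence of the tilted
Gaussian from the nominal one. The trace identity used is (I - θP)⁻¹ - I = θ(P⁻¹ - θI)⁻¹. -/
theorem gammaFun_eq (hP : P.PosDef) {θ : ℝ} (hθ : (1 - θ • P).PosDef) :
    gammaFun P θ = θ / 2 * (P⁻¹ - θ • 1)⁻¹.trace + 1 / 2 * Real.log (1 - θ • P).det := by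
  have hinv : (P⁻¹ - θ • 1)⁻¹ = P * (1 - θ • P)⁻¹ := by
    refine inv_eq_right_inv ?_
    rw [← Matrix.mul_assoc, sub_mul, nonsing_inv_mul _ hP.det_pos.ne'.isUnit, smul_mul_assoc,
      one_mul, mul_nonsing_inv _ hθ.det_pos.ne'.isUnit]
  have h2 : (1 - θ • P)⁻¹ - 1 = θ • (P⁻¹ - θ • 1)⁻¹ := by
    rw [hinv, ← smul_mul_assoc, sub_eq_iff_eq_add]
    have := mul_nonsing_inv _ hθ.det_pos.ne'.isUnit
    rwa [sub_mul, one_mul, sub_eq_iff_eq_add, add_comm] at this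
  rw [gammaFun, h2, trace_smul, smul_eq_mul]
  ring

end Spectral

/-! ### The divergence ball: least favorable density and minimax estimator -/

section Ball

open InformationTheory

variable {n m : ℕ}

theorem cost_eq_lintegral_densityMeasure {q : (Fin n ⊕ Fin m → ℝ) → ℝ} (hq : Measurable q)
    {g : (Fin m → ℝ) → Fin n → ℝ} (hg : Measurable g) :
    cost q g = 2⁻¹ * ∫⁻ z, ENNReal.ofReal (predError g z ⬝ᵥ predError g z) ∂densityMeasure q := by
  rw [cost, lintegral_densityMeasure hq
    (measurable_dotProduct_self (measurable_predError hg)).ennreal_ofReal]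

variable (mx : Fin n → ℝ) (my : Fin m → ℝ) {P : Matrix (Fin n) (Fin n) ℝ}
  (Kxy : Matrix (Fin n) (Fin m) ℝ) {Ky : Matrix (Fin m) (Fin m) ℝ}

/-- An affine function is square integrable as soon as the coordinates are, and every density in the
ball has finite second moments. -/
theorem affineEstimator_mem_estimators (hP : P.PosDef) (hKy : Ky.PosDef) (c : ℝ) :
    affineEstimator mx my Kxy Ky ∈ estimators (blockGaussian mx my P Kxy Ky) c := by
  have hg := measurable_affineEstimator mx my Kxy (Ky := Ky)
  refine ⟨hg, fun q hq => ?_⟩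
  have := hq.1.isProbabilityMeasure
  have hK := posDef_blockCovariance Kxy hP hKy
  obtain ⟨ε, hε, hKε⟩ := hK.inv.exists_sub_smul_one
  have hmem : ∀ i, MemLp (fun z : Fin n ⊕ Fin m → ℝ =>
      affineEstimator mx my Kxy Ky (z ∘ Sum.inr) i) 2 (densityMeasure q) := fun i => by
    refine (memLp_const (mx i)).add (?_ : MemLp (fun z : Fin n ⊕ Fin m → ℝ =>
      ∑ j, (Kxy * Ky⁻¹) i j * (z (Sum.inr j) - my j)) 2 (densityMeasure q))
    exact memLp_finsetSum _ fun j _ =>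
      (memLp_eval_sub_of_mem_klBall hK hε hKε hq (Sum.inr j)).const_mul _
  have hint : Integrable (fun z : Fin n ⊕ Fin m → ℝ =>
      affineEstimator mx my Kxy Ky (z ∘ Sum.inr) ⬝ᵥ affineEstimator mx my Kxy Ky (z ∘ Sum.inr))
      (densityMeasure q) := by
    simp only [dotProduct, ← pow_two]
    exact integrable_finsetSum _ fun i _ => (hmem i).integrable_sq
  have hm : Measurable fun z : Fin n ⊕ Fin m → ℝ => ENNReal.ofReal
      (affineEstimator mx my Kxy Ky (z ∘ Sum.inr) ⬝ᵥ
        affineEstimator mx my Kxy Ky (z ∘ Sum.inr)) :=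
    (measurable_dotProduct_self (hg.comp measurable_comp_inr)).ennreal_ofReal
  rw [← lintegral_densityMeasure hq.1.measurable hm]
  exact (hasFiniteIntegral_iff_ofReal (ae_of_all _ fun z => dotProduct_self_nonneg _)).1 hint.2

/-- The tilted Gaussian is the unique least favorable density for the affine estimator. -/
theorem isLeastFavorable_blockGaussian (hP : P.PosDef) (hKy : Ky.PosDef) {θ c : ℝ} (hθ0 : 0 < θ)
    (hθ : (1 - θ • P).PosDef) (hc : gammaFun P θ = c) :
    IsLeastFavorable (blockGaussian mx my P Kxy Ky) c (affineEstimator mx my Kxy Ky)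
      (blockGaussian mx my (P⁻¹ - θ • 1)⁻¹ Kxy Ky) ∧
    ∀ q, IsLeastFavorable (blockGaussian mx my P Kxy Ky) c (affineEstimator mx my Kxy Ky) q →
      q =ᵐ[volume] blockGaussian mx my (P⁻¹ - θ • 1)⁻¹ Kxy Ky := by
  have hT := posDef_inv_sub_smul_one hP hθ0.le hθ
  set g := affineEstimator mx my Kxy Ky with hgdef
  set q₀ := blockGaussian mx my P Kxy Ky with hq₀def
  set q' := blockGaussian mx my (P⁻¹ - θ • 1)⁻¹ Kxy Ky with hq'def
  have hg : Measurable g := measurable_affineEstimator mx my Kxy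
  have hq₀ : IsProbDensity q₀ := isProbDensity_blockGaussian mx my Kxy hP hKy
  have hq' : IsProbDensity q' := isProbDensity_blockGaussian mx my Kxy hT.inv hKy
  have := hq₀.isProbabilityMeasure
  have := hq'.isProbabilityMeasure
  set sq : (Fin n ⊕ Fin m → ℝ) → ℝ := fun z => predError g z ⬝ᵥ predError g z with hsq
  have hsqm : Measurable sq := measurable_dotProduct_self (measurable_predError hg)
  have hsq0 : ∀ z, 0 ≤ sq z := fun z => dotProduct_self_nonneg _
  obtain ⟨hexp, hexpint, htilt⟩ := tilted_densityMeasure hq₀ hq' (hsqm.const_mul (θ / 2))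
    fun z => blockGaussian_tilt mx my Kxy hP hKy hT z
  have hlin' : ∫⁻ z, ENNReal.ofReal (sq z) ∂densityMeasure q' =
      ENNReal.ofReal (P⁻¹ - θ • 1)⁻¹.trace := by
    have h := cost_blockGaussian_affineEstimator mx my Kxy hT.inv hKy
    rw [cost_eq_lintegral_densityMeasure hq'.measurable hg] at h
    exact (ENNReal.mul_right_inj (by simp) (by simp)).1 h
  have hsqint' : Integrable sq (densityMeasure q') := by
    refine ⟨hsqm.aestronglyMeasurable, ?_⟩
    rw [hasFiniteIntegral_iff_ofReal (ae_of_all _ hsq0), hlin']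
    exact ENNReal.ofReal_lt_top
  have hsqE' : ∫ z, sq z ∂densityMeasure q' = (P⁻¹ - θ • 1)⁻¹.trace := by
    rw [integral_eq_lintegral_of_nonneg_ae (ae_of_all _ hsq0) hsqm.aestronglyMeasurable, hlin',
      ENNReal.toReal_ofReal hT.inv.posSemidef.trace_nonneg]
  have hcost : ∀ q, IsProbDensity q → Integrable sq (densityMeasure q) →
      cost q g = 2⁻¹ * ENNReal.ofReal (∫ z, sq z ∂densityMeasure q) := fun q hq hint => by
    rw [cost_eq_lintegral_densityMeasure hq.measurable hg,
      ofReal_integral_eq_lintegral_ofReal hint (ae_of_all _ hsq0)]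
  -- The choice of θ puts the tilted density exactly on the boundary of the ball, so membership in
  -- the ball becomes the divergence comparison that `integral_le_integral_tilted` needs.
  have hKL : klDiv (densityMeasure q') (densityMeasure q₀) = ENNReal.ofReal c := by
    have h := toReal_klDiv_tilted hexp (by rw [htilt]; exact hsqint'.const_mul _)
      (hsqm.const_mul (θ / 2))
    rw [htilt, hexpint, Real.log_exp, integral_const_mul, hsqE', sub_neg_eq_add,
      ← gammaFun_eq hP hθ, hc] at h
    rw [← h.2, ENNReal.ofReal_toReal h.1]
  have hball : ∀ q ∈ klBall q₀ c, Integrable sq (densityMeasure q) ∧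
      ∫ z, sq z ∂densityMeasure q ≤ ∫ z, sq z ∂densityMeasure q' ∧
      (∫ z, sq z ∂densityMeasure q' ≤ ∫ z, sq z ∂densityMeasure q →
        densityMeasure q = densityMeasure q') := by
    intro q hq
    have := hq.1.isProbabilityMeasure
    have hφint := integrable_of_klDiv_ne_top (μ := densityMeasure q) (hsqm.const_mul (θ / 2))
      (fun z => mul_nonneg (by positivity) (hsq0 z)) hexp
      (ne_top_of_le_ne_top ENNReal.ofReal_ne_top hq.2)
    have h := integral_le_integral_tilted (hsqm.const_mul (θ / 2)) hexp
      (by rw [htilt]; exact hsqint'.const_mul _) hφint (by rw [htilt, hKL]; exact hq.2)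
    rw [htilt, integral_const_mul, integral_const_mul, mul_le_mul_iff_right₀ (by positivity),
      mul_le_mul_iff_right₀ (by positivity)] at h
    have h2 := hφint.const_mul (2 / θ)
    simp only [← mul_assoc, div_mul_div_cancel₀ hθ0.ne', div_self (two_ne_zero' ℝ), one_mul] at h2
    exact ⟨h2, h⟩
  refine ⟨⟨⟨hq', hKL.le⟩, fun q hq => ?_⟩, fun q hq => ?_⟩
  · obtain ⟨hint, hle, -⟩ := hball q hq
    rw [hcost q hq.1 hint, hcost q' hq' hsqint']
    gcongr
  · obtain ⟨hint, hle, huniq⟩ := hball q hq.1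
    have hge := hq.2 q' ⟨hq', hKL.le⟩
    rw [hcost q hq.1.1 hint, hcost q' hq' hsqint',
      ENNReal.mul_le_mul_iff_right (by simp) (by simp),
      ENNReal.ofReal_le_ofReal_iff (integral_nonneg hsq0)] at hge
    exact ae_eq_of_densityMeasure_eq hq.1.1 hq' (huniq hge)

/-- With q* the least favorable density: sup_q cost(q, g*) ≤ cost(q*, g*) ≤ cost(q*, g) ≤ sup_q
cost(q, g). If g is minimax as well, cost(q*, g) ≤ cost(q*, g*), and strictness of the mean square
optimum identifies g. -/
theorem isMinimaxEstimator_blockGaussian (hn : 0 < n) (hP : P.PosDef) (hKy : Ky.PosDef) {c : ℝ}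
    (hc : 0 < c) :
    IsMinimaxEstimator (blockGaussian mx my P Kxy Ky) c (affineEstimator mx my Kxy Ky) ∧
    ∀ g, IsMinimaxEstimator (blockGaussian mx my P Kxy Ky) c g →
      g =ᵐ[volume] affineEstimator mx my Kxy Ky := by
  obtain ⟨θ, ⟨hθ0, hθ, hθc⟩, -⟩ := existsUnique_gammaFun_eq hn hP hc
  obtain ⟨⟨hmem, hmax⟩, -⟩ := isLeastFavorable_blockGaussian mx my Kxy hP hKy hθ0 hθ hθc
  have hT := (posDef_inv_sub_smul_one hP hθ0.le hθ).inv
  have hest := affineEstimator_mem_estimators mx my Kxy hP hKy c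
  have hsup := iSup₂_le hmax
  refine ⟨⟨hest, fun g hg => hsup.trans ((cost_affineEstimator_le mx my Kxy hT hKy hg.1).trans ?_)⟩,
    fun g hg => ae_eq_affineEstimator_of_cost_le mx my Kxy hT hKy hg.1.1 ?_⟩
  · exact le_iSup₂ (f := fun q _ => cost q g) _ hmem
  · exact (le_iSup₂ (f := fun q _ => cost q g) _ hmem).trans ((hg.2 _ hest).trans hsup)

end Ball

/-! ### The sigma-point matrices and the predictor at the observation -/

section SigmaPoint

variable {n m p : ℕ}

/-- Full row rank means independent rows, so Aᵀ is injective. This noise term makes `Ky` and `PNext`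
positive definite, the weighted sums being only semidefinite. -/
theorem Matrix.posDef_mul_transpose_self_of_rank_eq {k l : ℕ} {A : Matrix (Fin k) (Fin l) ℝ}
    (hA : A.rank = k) : (A * Aᵀ).PosDef := by
  rw [← conjTranspose_eq_transpose_of_trivial]
  refine PosDef.mul_conjTranspose_self A (vecMul_injective_iff.2 ?_)
  rw [linearIndependent_iff_card_eq_finrank_span, Fintype.card_fin, Set.finrank,
    ← rank_eq_finrank_span_row, hA]

theorem posSemidef_sum_smul_vecMulVec {k : ℕ} {w : Fin p → ℝ} (hw : ∀ i, 0 ≤ w i)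
    (v : Fin p → Fin k → ℝ) : (∑ i, w i • vecMulVec (v i) (v i)).PosSemidef :=
  posSemidef_sum _ fun i _ => (posSemidef_vecMulVec_self_star (v i)).smul (hw i)

theorem sum_smul_vecMulVec_mulVec {k l : ℕ} (w : Fin p → ℝ) (u : Fin p → Fin k → ℝ)
    (v : Fin p → Fin l → ℝ) (b : Fin l → ℝ) :
    (∑ i, w i • vecMulVec (u i) (v i)) *ᵥ b = ∑ i, (w i * (v i ⬝ᵥ b)) • u i := by
  rw [sum_mulVec]
  refine Finset.sum_congr rfl fun i _ => ?_
  rw [smul_mulVec, vecMulVec_mulVec, mul_smul, op_smul_eq_smul]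

namespace FilterStep

variable (s : FilterStep n m p)

theorem posDef_Ky : s.Ky.PosDef :=
  PosDef.posSemidef_add (posSemidef_sum_smul_vecMulVec s.rule.Wc_nonneg _)
    (posDef_mul_transpose_self_of_rank_eq s.model.rank_D)

theorem posDef_PNext : s.PNext.PosDef :=
  PosDef.posSemidef_add (posSemidef_sum_smul_vecMulVec s.rule.Wc_nonneg _)
    (posDef_mul_transpose_self_of_rank_eq s.model.rank_B)

/-- `Kxy` is affine in `mx`, so requiring the predictor at the observation to equal `xNext` is a
linear equation for `mx` in which the coefficient of `mx` is `den`; the definition of `mx` is its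
solution. -/
theorem predictor_y (hden : s.den ≠ 0) : s.predictor s.y = s.xNext := by
  have hmx : s.den • s.mx = s.xNext -
      ∑ i, (s.rule.Wc i * (s.hErr i ⬝ᵥ (s.Ky⁻¹ *ᵥ (s.y - s.my)))) • s.model.f (s.X i) := by
    rw [mx, smul_inv_smul₀ hden, ← mulVec_mulVec, sum_smul_vecMulVec_mulVec]
  have hK : (s.Kxy * s.Ky⁻¹) *ᵥ (s.y - s.my) =
      ∑ i, (s.rule.Wc i * (s.hErr i ⬝ᵥ (s.Ky⁻¹ *ᵥ (s.y - s.my)))) • s.model.f (s.X i) -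
        (∑ i, s.rule.Wc i * (s.hErr i ⬝ᵥ (s.Ky⁻¹ *ᵥ (s.y - s.my)))) • s.mx := by
    rw [← mulVec_mulVec, Kxy, sum_smul_vecMulVec_mulVec, Finset.sum_smul,
      ← Finset.sum_sub_distrib]
    simp_rw [smul_sub]
  rw [den, sub_smul, one_smul] at hmx
  rw [predictor, hK, add_sub_left_comm, hmx]
  abel

end FilterStep

end SigmaPoint

end

theorem theorem1 {n m p : ℕ} (hn : 0 < n) (s : FilterStep n m p) (hPt : s.Pt.PosDef)
    (hden : s.den ≠ 0) (c : ℝ) (hc : 0 < c) :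
    -- the center of the ball is a nondegenerate Gaussian density
    s.K.PosDef ∧ IsProbDensity s.nominal ∧
    -- the minimax estimator, and its value at the actual observation
    IsMinimaxEstimator s.nominal c s.predictor ∧
    (∀ g, IsMinimaxEstimator s.nominal c g → g =ᵐ[volume] s.predictor) ∧
    s.predictor s.y = s.xNext ∧
    -- the nominal covariance matrix of the prediction error
    s.PNext.PosDef ∧
    HasErrorCovariance s.nominal s.predictor s.PNext ∧
    condDensity s.nominal s.y = gaussianDensity s.xNext s.PNext ∧
    -- the risk sensitivity parameter
    (∃! θ : ℝ, 0 < θ ∧ (1 - θ • s.PNext).PosDef ∧ gammaFun s.PNext θ = c) ∧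
    ∀ θ : ℝ, 0 < θ → (1 - θ • s.PNext).PosDef → gammaFun s.PNext θ = c →
      (s.PtNext θ).PosDef ∧
      -- the least favorable density, and the saddle point property
      IsLeastFavorable s.nominal c s.predictor (s.leastFavorable θ) ∧
      (∀ q, IsLeastFavorable s.nominal c s.predictor q → q =ᵐ[volume] s.leastFavorable θ) ∧
      (∀ g ∈ estimators s.nominal c,
        cost (s.leastFavorable θ) s.predictor ≤ cost (s.leastFavorable θ) g) ∧
      -- the least favorable covariance matrix of the prediction error
      HasErrorCovariance (s.leastFavorable θ) s.predictor (s.PtNext θ) ∧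
      -- the least favorable a priori density at the next step
      condDensity (s.leastFavorable θ) s.y = gaussianDensity s.xNext (s.PtNext θ) := by
  have hP := s.posDef_PNext
  have hKy := s.posDef_Ky
  -- By definition, `nominal` and `leastFavorable θ` are the block Gaussians with error covariance
  -- `PNext` and `PtNext θ`, and `predictor` is their common affine estimator.
  obtain ⟨hmin, huniq⟩ := isMinimaxEstimator_blockGaussian s.mx s.my s.Kxy hn hP hKy hc
  have hy := s.predictor_y hden
  refine ⟨posDef_blockCovariance s.Kxy hP hKy, isProbDensity_blockGaussian s.mx s.my s.Kxy hP hKy,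
    hmin, huniq, hy, hP, hasErrorCovariance_blockGaussian s.mx s.my s.Kxy hP hKy, ?_,
    existsUnique_gammaFun_eq hn hP hc, fun θ hθ0 hθ hθc => ?_⟩
  · rw [← hy]
    exact condDensity_blockGaussian s.mx s.my s.Kxy hP hKy s.y
  have hT : (s.PtNext θ).PosDef := (posDef_inv_sub_smul_one hP hθ0.le hθ).inv
  obtain ⟨hlf, hlfu⟩ := isLeastFavorable_blockGaussian s.mx s.my s.Kxy hP hKy hθ0 hθ hθc
  refine ⟨hT, hlf, hlfu, fun g hg => cost_affineEstimator_le s.mx s.my s.Kxy hT hKy hg.1,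
    hasErrorCovariance_blockGaussian s.mx s.my s.Kxy hT hKy, ?_⟩
  rw [← hy]
  exact condDensity_blockGaussian s.mx s.my s.Kxy hT hKy s.y
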